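/- All Banach algebras are complex and need not have an identity element; morphisms are continuous (not necessarily contractive) algebra homomorphisms, not required to preserve identity elements. For a Banach algebra $A$ let $A^+=\mathbb{C}\oplus A$ be its unitization and let $GL_n(A)$ be the kernel of $GL_n(A^+)\to GL_n(A^+/A)=GL_n(\mathbb{C})$, with its topology as a subgroup of the group of units of $M_n(A^+)$; if $A$ has an identity element, this is canonically the usual topological group of invertible $n\times n$ matrices over $A$. A morphism $f\colon A\to B$ induces a homomorphism $GL_n(A)\to GL_n(B)$, $1+a\mapsto 1+f(a)$ (with $f$ applied entrywise), again denoted by $f$. Let $\beta\colon A\to B$, $\gamma\colon A\to C$, $\varphi\colon B\to D$ and $\psi\colon C\to D$ be morphisms of Banach algebras with $\varphi\beta=\psi\gamma$. Suppose that 1. the square is a pullback square: $a\mapsto(\beta(a),\gamma(a))$ is an isomorphism of Banach algebras (not necessarily isometric) from $A$ onto $\{(b,c)\in B\oplus C:\varphi(b)=\psi(c)\}$; 2. $\varphi[B]+\psi[C]=D$; 3. at least one of $\varphi$, $\psi$ has dense image. Then for every $n$ the map $$\pi\colon GL_n(B)\times GL_n(C)\longrightarrow GL_n(D),\qquad \pi(S,T)=\varphi(S)^{-1}\psi(T),$$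 is a Serre fibration, that is, it is continuous and has the homotopy lifting property for maps from the cubes $[0,1]^k$, $k\ge 0$. Moreover, the image of $\pi$ is open and closed in $GL_n(D)$, and $\pi$ is a principal $GL_n(A)$-bundle over its image, for the left action $Q\cdot(S,T)=(\beta(Q)S,\gamma(Q)T)$: the action is continuous and preserves the fibres of $\pi$, and every point of the image has a neighbourhood $U$, open in the image, for which there is a $GL_n(A)$-equivariant homeomorphism $\pi^{-1}[U]\cong GL_n(A)\times U$ over $U$, where $GL_n(A)$ acts on $GL_n(A)\times U$ by left translation of the first factor. -/

import Mathlib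

noncomputable section

namespace BanachAlg

section GeneralLinear

variable (A : Type*) [NonUnitalNormedRing A] [NormedSpace ℂ A] [IsScalarTower ℂ A A]
  [SMulCommClass ℂ A A]

/-- The unital Banach algebra `A⁺ = ℂ ⊕ A`, with the norm `‖(z, a)‖ = ‖z‖ + ‖a‖`, which contains
`A` as a closed two-sided ideal. -/
abbrev Unit1 : Type _ := WithLp 1 (Unitization ℂ A)

/-- The quotient morphism `A⁺ → A⁺ / A = ℂ`, `(z, a) ↦ z`. -/
def Unit1.scalarPart : Unit1 A →ₐ[ℂ] ℂ :=
  (Unitization.fstHom ℂ A).comp (WithLp.unitizationAlgEquiv (𝕜 := ℂ) (A := A) ℂ).toAlgHom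

/-- The group homomorphism between groups of invertible matrices which is induced by a
(unital) ring homomorphism, entry by entry. -/
def unitsMatrixMap (n : ℕ) {R S : Type*} [Ring R] [Ring S] (f : R →+* S) :
    (Matrix (Fin n) (Fin n) R)ˣ →* (Matrix (Fin n) (Fin n) S)ˣ :=
  Units.map (f.mapMatrix : Matrix (Fin n) (Fin n) R →+* Matrix (Fin n) (Fin n) S).toMonoidHom

/-- `GL_n(A)` for a Banach algebra `A`, unital or not: the kernel of the homomorphism
`GL_n(A⁺) → GL_n(A⁺ / A)`, with the topology inherited from the unit group `GL_n(A⁺)`. When `A` has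
an identity element, this is the usual group of invertible matrices over `A`, see
`GLn.equivUnits`. -/
def GLnSubgroup (n : ℕ) : Subgroup (Matrix (Fin n) (Fin n) (Unit1 A))ˣ :=
  (unitsMatrixMap n (Unit1.scalarPart A).toRingHom).ker

/-- The topological group `GL_n(A)`. -/
abbrev GLn (n : ℕ) : Type _ := GLnSubgroup A n

end GeneralLinear

section Functoriality

variable {A B : Type*}
  [NonUnitalNormedRing A] [NormedSpace ℂ A] [IsScalarTower ℂ A A] [SMulCommClass ℂ A A]
  [NonUnitalNormedRing B] [NormedSpace ℂ B] [IsScalarTower ℂ B B] [SMulCommClass ℂ B B]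

/-- The unital extension `A⁺ → B⁺`, `(z, a) ↦ (z, f a)`, of an algebra homomorphism `f`. -/
def Unit1.map (f : A →ₙₐ[ℂ] B) : Unit1 A →ₐ[ℂ] Unit1 B :=
  (WithLp.unitizationAlgEquiv (𝕜 := ℂ) (A := B) ℂ).symm.toAlgHom.comp
    ((Unitization.lift ((Unitization.inrNonUnitalAlgHom ℂ B).comp f)).comp
      (WithLp.unitizationAlgEquiv (𝕜 := ℂ) (A := A) ℂ).toAlgHom)

theorem Unit1.map_fst (f : A →ₙₐ[ℂ] B) (x : Unit1 A) :
    (WithLp.ofLp (Unit1.map f x)).fst = (WithLp.ofLp x).fst := by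
  simp [Unit1.map, Unitization.algebraMap_eq_inl]

theorem Unit1.map_snd (f : A →ₙₐ[ℂ] B) (x : Unit1 A) :
    (WithLp.ofLp (Unit1.map f x)).snd = f (WithLp.ofLp x).snd := by
  simp [Unit1.map, Unitization.algebraMap_eq_inl]

theorem Unit1.scalarPart_map (f : A →ₙₐ[ℂ] B) (x : Unit1 A) :
    Unit1.scalarPart B (Unit1.map f x) = Unit1.scalarPart A x :=
  Unit1.map_fst f x

/-- The homomorphism `GL_n(A) → GL_n(B)` induced by an algebra homomorphism `f : A → B`,
that is `1 + (a i j) ↦ 1 + (f (a i j))`. -/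
def GLn.map (n : ℕ) (f : A →ₙₐ[ℂ] B) : GLn A n →* GLn B n :=
  ((unitsMatrixMap n (Unit1.map f).toRingHom).comp (GLnSubgroup A n).subtype).codRestrict
    (GLnSubgroup B n) (by
      rintro ⟨S, hS⟩
      rw [GLnSubgroup, MonoidHom.mem_ker] at hS ⊢
      rw [← hS]
      ext i j
      exact Unit1.scalarPart_map f _)

end Functoriality

section Comparison

/-- For a unital algebra `A`, the homomorphism `A⁺ → A`, `(z, a) ↦ z • 1 + a`. -/
def Unit1.toUnital (A : Type*) [NormedRing A] [NormedAlgebra ℂ A] : Unit1 A →ₐ[ℂ] A :=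
  (Unitization.lift (NonUnitalAlgHom.id ℂ A)).comp
    (WithLp.unitizationAlgEquiv (𝕜 := ℂ) (A := A) ℂ).toAlgHom

theorem Unit1.toUnital_apply {A : Type*} [NormedRing A] [NormedAlgebra ℂ A] (x : Unit1 A) :
    Unit1.toUnital A x = algebraMap ℂ A (WithLp.ofLp x).fst + (WithLp.ofLp x).snd := by
  simp [Unit1.toUnital]

theorem Unit1.scalarPart_apply {A : Type*} [NormedRing A] [NormedAlgebra ℂ A] (x : Unit1 A) :
    Unit1.scalarPart A x = (WithLp.ofLp x).fst := rfl

theorem Unit1.continuous_ofLp_fst_snd (A : Type*) [NormedRing A] [NormedAlgebra ℂ A] :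
    Continuous fun x : Unit1 A ↦ ((WithLp.ofLp x).fst, (WithLp.ofLp x).snd) :=
  (WithLp.prod_continuous_ofLp 1 ℂ A).comp
    (WithLp.uniformEquiv_unitization_addEquiv_prod ℂ A).continuous

/-- For a unital algebra `A`, the algebra `A⁺` is the product `ℂ × A`. -/
def Unit1.equivProd (A : Type*) [NormedRing A] [NormedAlgebra ℂ A] : Unit1 A ≃+* ℂ × A where
  toFun x := (Unit1.scalarPart A x, Unit1.toUnital A x)
  invFun p := WithLp.toLp 1 ((Unitization.inl p.1 : Unitization ℂ A)
    + (Unitization.inr (p.2 - algebraMap ℂ A p.1) : Unitization ℂ A))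
  left_inv x := by
    apply WithLp.ofLp_injective
    ext <;> simp [Unit1.toUnital_apply, Unit1.scalarPart_apply]
  right_inv p := by
    ext <;> simp [-Unitization.inr_sub, Unit1.toUnital_apply, Unit1.scalarPart_apply]
  map_mul' x y := by simp
  map_add' x y := by simp

theorem Unit1.continuous_equivProd (A : Type*) [NormedRing A] [NormedAlgebra ℂ A] :
    Continuous (Unit1.equivProd A) := by
  have h := Unit1.continuous_ofLp_fst_snd A
  have h2 : ⇑(Unit1.equivProd A) = (fun p : ℂ × A ↦ (p.1, algebraMap ℂ A p.1 + p.2)) ∘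
      fun x : Unit1 A ↦ ((WithLp.ofLp x).fst, (WithLp.ofLp x).snd) := by
    funext x
    exact Prod.ext rfl (Unit1.toUnital_apply x)
  rw [h2]
  have h3 : Continuous (algebraMap ℂ A) := continuous_algebraMap ℂ A
  exact Continuous.comp (by fun_prop) h

theorem Unit1.continuous_equivProd_symm (A : Type*) [NormedRing A] [NormedAlgebra ℂ A] :
    Continuous (Unit1.equivProd A).symm := by
  have h3 : Continuous (algebraMap ℂ A) := continuous_algebraMap ℂ A
  have h2 : ⇑(Unit1.equivProd A).symm =
      (WithLp.uniformEquiv_unitization_addEquiv_prod ℂ A).symm ∘ WithLp.toLp 1 ∘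
        fun p : ℂ × A ↦ (p.1, p.2 - algebraMap ℂ A p.1) := by
    funext p
    apply (WithLp.uniformEquiv_unitization_addEquiv_prod ℂ A).injective
    rw [Function.comp_apply, UniformEquiv.apply_symm_apply]
    apply WithLp.ofLp_injective
    change (((Unitization.inl p.1 : Unitization ℂ A)
      + (Unitization.inr (p.2 - algebraMap ℂ A p.1) : Unitization ℂ A)).fst,
      ((Unitization.inl p.1 : Unitization ℂ A)
      + (Unitization.inr (p.2 - algebraMap ℂ A p.1) : Unitization ℂ A)).snd) = _
    simp [-Unitization.inr_sub]
  rw [h2]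
  exact (UniformEquiv.continuous _).comp
    ((WithLp.prod_continuous_toLp 1 ℂ A).comp (by fun_prop))

/-- Over a unital algebra `A`, a matrix `M` gives the matrix `(1, M)` over `ℂ × A = A⁺`. -/
def Unit1.matrixHom (A : Type*) [NormedRing A] [NormedAlgebra ℂ A] (n : ℕ) :
    Matrix (Fin n) (Fin n) A →* Matrix (Fin n) (Fin n) (Unit1 A) where
  toFun M := Matrix.of fun i j ↦
    (Unit1.equivProd A).symm ((1 : Matrix (Fin n) (Fin n) ℂ) i j, M i j)
  map_one' := by
    ext1 i j
    apply (Unit1.equivProd A).injective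
    rw [Matrix.of_apply, RingEquiv.apply_symm_apply]
    by_cases h : i = j
    · subst h
      simp only [Matrix.one_apply_eq, map_one]
      rfl
    · simp only [Matrix.one_apply_ne h, map_zero]
      rfl
  map_mul' M N := by
    ext1 i j
    apply (Unit1.equivProd A).injective
    simp only [Matrix.of_apply, Matrix.mul_apply, RingEquiv.apply_symm_apply, map_sum, map_mul]
    refine Prod.ext ?_ ?_
    · simp [Prod.fst_sum, Matrix.one_apply]
    · simp [Prod.snd_sum]

/-- If `A` has an identity element, then `GL_n(A)` is, as a topological group, the group of
invertible `n × n` matrices over `A`. -/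
def GLn.equivUnits (A : Type*) [NormedRing A] [NormedAlgebra ℂ A] (n : ℕ) :
    GLn A n ≃ₜ* (Matrix (Fin n) (Fin n) A)ˣ where
  toFun S := unitsMatrixMap n (Unit1.toUnital A).toRingHom S
  invFun S := ⟨Units.map (Unit1.matrixHom A n) S, by
    rw [GLnSubgroup, MonoidHom.mem_ker]
    ext i j
    change ((Unit1.equivProd A) ((Unit1.equivProd A).symm _)).1 = _
    rw [RingEquiv.apply_symm_apply]
    rfl⟩
  left_inv := by
    rintro ⟨S, hS⟩
    rw [GLnSubgroup, MonoidHom.mem_ker] at hS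
    apply Subtype.ext
    ext1
    ext1 i j
    apply (Unit1.equivProd A).injective
    change (Unit1.equivProd A) ((Unit1.equivProd A).symm _) = _
    rw [RingEquiv.apply_symm_apply]
    refine Prod.ext ?_ rfl
    have h := congrArg (fun u : (Matrix (Fin n) (Fin n) ℂ)ˣ ↦ (u : Matrix (Fin n) (Fin n) ℂ) i j) hS
    exact h.symm
  right_inv S := by
    ext i j
    change ((Unit1.equivProd A) ((Unit1.equivProd A).symm _)).2 = _
    rw [RingEquiv.apply_symm_apply]
  map_mul' S T := by simp
  continuous_toFun := by
    refine Continuous.comp (g := unitsMatrixMap n (Unit1.toUnital A).toRingHom) ?_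
      continuous_subtype_val
    refine Continuous.units_map (((Unit1.toUnital A).toRingHom.mapMatrix :
      Matrix (Fin n) (Fin n) (Unit1 A) →+* Matrix (Fin n) (Fin n) A).toMonoidHom) ?_
    exact Continuous.matrix_map continuous_id
      (continuous_snd.comp (Unit1.continuous_equivProd A))
  continuous_invFun := by
    refine Continuous.subtype_mk (Continuous.units_map (Unit1.matrixHom A n) ?_) _
    refine continuous_matrix fun i j ↦ (Unit1.continuous_equivProd_symm A).comp ?_
    exact continuous_const.prodMk (Continuous.matrix_elem continuous_id i j)

/-- For a unital morphism of unital algebras, `GLn.map` is the entrywise map on invertible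
matrices. -/
theorem GLn.equivUnits_map {A B : Type*} [NormedRing A] [NormedAlgebra ℂ A] [NormedRing B]
    [NormedAlgebra ℂ B] (n : ℕ) (f : A →ₐ[ℂ] B) (S : GLn A n) :
    GLn.equivUnits B n (GLn.map n (f : A →ₙₐ[ℂ] B) S) =
      unitsMatrixMap n f.toRingHom (GLn.equivUnits A n S) := by
  ext i j
  change Unit1.toUnital B (Unit1.map (f : A →ₙₐ[ℂ] B) _) = f (Unit1.toUnital A _)
  simp [Unit1.toUnital_apply, Unit1.map_fst, Unit1.map_snd]
  rfl

end Comparison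

section Square

variable {A B C D : Type*}
  [NonUnitalNormedRing A] [NormedSpace ℂ A] [IsScalarTower ℂ A A] [SMulCommClass ℂ A A]
  [NonUnitalNormedRing B] [NormedSpace ℂ B] [IsScalarTower ℂ B B] [SMulCommClass ℂ B B]
  [NonUnitalNormedRing C] [NormedSpace ℂ C] [IsScalarTower ℂ C C] [SMulCommClass ℂ C C]
  [NonUnitalNormedRing D] [NormedSpace ℂ D] [IsScalarTower ℂ D D] [SMulCommClass ℂ D D]

/-- The square with sides `β : A → B`, `γ : A → C`, `φ : B → D`, `ψ : C → D` commutes, and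
`a ↦ (β a, γ a)` is an isomorphism (of algebras and of topological spaces) from `A` onto
`{(b, c) ∈ B ⊕ C : φ b = ψ c}`. -/
structure IsPullbackSquare (β : A →ₙₐ[ℂ] B) (γ : A →ₙₐ[ℂ] C) (φ : B →ₙₐ[ℂ] D)
    (ψ : C →ₙₐ[ℂ] D) : Prop where
  comm : ∀ a, φ (β a) = ψ (γ a)
  isHomeomorph : IsHomeomorph
    (fun a : A ↦ (⟨(β a, γ a), comm a⟩ : {p : B × C // φ p.1 = ψ p.2}))

/-- The map `π : GL_n(B) × GL_n(C) → GL_n(D)`, `(S, T) ↦ φ(S)⁻¹ ψ(T)`. -/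
def quotientMap (n : ℕ) (φ : B →ₙₐ[ℂ] D) (ψ : C →ₙₐ[ℂ] D) (p : GLn B n × GLn C n) : GLn D n :=
  (GLn.map n φ p.1)⁻¹ * GLn.map n ψ p.2

/-- The left action `Q • (S, T) = (β(Q) S, γ(Q) T)` of `GL_n(A)` on `GL_n(B) × GL_n(C)`. -/
@[reducible]
def glnAction (n : ℕ) (β : A →ₙₐ[ℂ] B) (γ : A →ₙₐ[ℂ] C) :
    MulAction (GLn A n) (GLn B n × GLn C n) :=
  MulAction.compHom _ ((GLn.map n β).prod (GLn.map n γ))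

end Square

end BanachAlg

/-- A continuous map is a Serre fibration if it has the homotopy lifting property for maps from
the cubes `[0, 1]^k`, `k = 0, 1, 2, …`. -/
structure IsSerreFibration {E X : Type*} [TopologicalSpace E] [TopologicalSpace X]
    (p : E → X) : Prop where
  continuous : Continuous p
  lifting : ∀ (k : ℕ) (f : (Fin k → unitInterval) → E)
    (H : unitInterval × (Fin k → unitInterval) → X),
    Continuous f → Continuous H → (∀ y, H (0, y) = p (f y)) →
    ∃ K : unitInterval × (Fin k → unitInterval) → E,
      Continuous K ∧ (∀ y, K (0, y) = f y) ∧ ∀ z, p (K z) = H z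

/-- `p : E → X` is a principal `G`-bundle, for a given left action of the topological group `G` on
`E`: the action is continuous and preserves the fibres of `p`, and locally over `X` there are
`G`-equivariant homeomorphisms over the base between `E` and the product with fibre `G`, on which
`G` acts by left translation. -/
structure IsPrincipalBundle (G : Type*) {E X : Type*} [Group G] [TopologicalSpace G]
    [IsTopologicalGroup G] [TopologicalSpace E] [TopologicalSpace X] [action : MulAction G E]
    (p : E → X) : Prop where
  continuous : Continuous p
  continuous_smul : Continuous fun q : G × E ↦ q.1 • q.2
  map_smul : ∀ (g : G) (e : E), p (g • e) = p e
  locally_trivial : ∀ x : X, ∃ U : Set X, IsOpen U ∧ x ∈ U ∧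
    ∃ h : (p ⁻¹' U) ≃ₜ G × U,
      (∀ e, ((h e).2 : X) = p e) ∧
      ∀ (g : G) (e e' : p ⁻¹' U), (e' : E) = g • (e : E) → h e' = (g * (h e).1, (h e).2)

end

/-! Write S = 1 + b, T = 1 + c, W = 1 + d. Then π(S, T) = W means φ(S)W = ψ(T), that is ψ(c) -
φ(b)(1 + d) = d, which is linear in (b, c) once d is fixed. At d = 0 the operator is onto because
φ[B] + ψ[C] = D. A selection argument of Bartle–Graves type, stable under small perturbations of the
operator (`exists_continuous_solution_near_zero`), solves the equation continuously for small d. The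
solutions are small too, so 1 + b and 1 + c are invertible, and π has a continuous section near 1
(`exists_section_near_one`).

Most of what remains is formal, for homomorphisms f, g of topological groups and the map (S, T) ↦
f(S)⁻¹ g(T). Translations carry the section to every point of the image, which is therefore open.
Right multiplication by s(x)⁻¹ s(v) moves the fibre over x to the fibre over v, and this local
transport lifts homotopies (`exists_homotopy_lift_of_transport`). Two points of one fibre differ by
a unique element of the pullback group, which is GL_n(A) (`IsPullbackSquare.exists_map_eq`,
`IsPullbackSquare.isEmbedding_map`), so local sections give local trivializations.

Closedness uses density. If ψ has dense image, exponentials show that the closure K of ψ(GL_n(C)) is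
an open subgroup. It lies in the image of π, and if w is outside the image, so is the whole coset
wK. If φ has dense image, pass to inverses. Closedness also completes the fibration property over
all of GL_n(D): over the open complement there is nothing to lift. -/

noncomputable section

open Topology

namespace BanachAlg

/-! ### Coordinates on GL_n: the coefficient matrix a of 1 + a. -/

section Coefficients

variable {A B : Type*}
  [NonUnitalNormedRing A] [NormedSpace ℂ A] [IsScalarTower ℂ A A] [SMulCommClass ℂ A A]
  [NonUnitalNormedRing B] [NormedSpace ℂ B] [IsScalarTower ℂ B B] [SMulCommClass ℂ B B]
  {n : ℕ}

/-- The inclusion `A → A⁺`, `a ↦ (0, a)`. -/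
def Unit1.inr (A : Type*) [NonUnitalNormedRing A] [NormedSpace ℂ A] [IsScalarTower ℂ A A]
    [SMulCommClass ℂ A A] : A →L[ℂ] Unit1 A :=
  LinearMap.mkContinuous
    { toFun := fun a ↦ WithLp.toLp 1 (a : Unitization ℂ A)
      map_add' := fun a b ↦ by
        apply WithLp.ofLp_injective
        exact Unitization.inr_add ℂ a b
      map_smul' := fun z a ↦ by
        apply WithLp.ofLp_injective
        exact Unitization.inr_smul ℂ z a } 1
    (fun a ↦ by simp [WithLp.unitization_norm_inr])

/-- The projection `A⁺ → A`, `(z, a) ↦ a`. -/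
def Unit1.snd (A : Type*) [NonUnitalNormedRing A] [NormedSpace ℂ A] [IsScalarTower ℂ A A]
    [SMulCommClass ℂ A A] : Unit1 A →L[ℂ] A :=
  LinearMap.mkContinuous
    { toFun := fun x ↦ (WithLp.ofLp x).snd
      map_add' := fun _ _ ↦ rfl
      map_smul' := fun _ _ ↦ rfl } 1
    (fun x ↦ by
      rw [WithLp.unitization_norm_def, one_mul]
      exact le_add_of_nonneg_left (norm_nonneg _))

theorem Unit1.inr_mul (a b : A) : Unit1.inr A (a * b) = Unit1.inr A a * Unit1.inr A b := by
  apply WithLp.ofLp_injective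
  exact Unitization.inr_mul ℂ a b

@[simp]
theorem Unit1.snd_inr (a : A) : Unit1.snd A (Unit1.inr A a) = a := rfl

@[simp]
theorem Unit1.scalarPart_inr (a : A) : Unit1.scalarPart A (Unit1.inr A a) = 0 := rfl

@[simp]
theorem Unit1.snd_one : Unit1.snd A 1 = 0 := rfl

theorem Unit1.ext {x y : Unit1 A} (h₁ : Unit1.scalarPart A x = Unit1.scalarPart A y)
    (h₂ : Unit1.snd A x = Unit1.snd A y) : x = y := by
  apply WithLp.ofLp_injective
  exact Unitization.ext h₁ h₂

theorem Unit1.snd_map (f : A →ₙₐ[ℂ] B) (x : Unit1 A) :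
    Unit1.snd B (Unit1.map f x) = f (Unit1.snd A x) :=
  Unit1.map_snd f x

/-- The matrix `1 + a` over `A⁺`, for a matrix `a` over `A`. -/
def oneAdd (a : Matrix (Fin n) (Fin n) A) : Matrix (Fin n) (Fin n) (Unit1 A) :=
  1 + a.map (Unit1.inr A)

@[simp]
theorem oneAdd_zero : oneAdd (0 : Matrix (Fin n) (Fin n) A) = 1 := by
  simp [oneAdd]

/-- Quasi-multiplication a + b + ab allows computing in GL_n(A) with matrices over A alone. -/
theorem oneAdd_mul (a b : Matrix (Fin n) (Fin n) A) :
    oneAdd a * oneAdd b = oneAdd (a + b + a * b) := by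
  have h : (a * b).map (Unit1.inr A) = a.map (Unit1.inr A) * b.map (Unit1.inr A) := by
    ext1 i j
    simp [Matrix.mul_apply, Unit1.inr_mul]
  have h' : (a + b + a * b).map (Unit1.inr A) =
      a.map (Unit1.inr A) + b.map (Unit1.inr A) + (a * b).map (Unit1.inr A) := by
    ext1 i j
    simp
  simp only [oneAdd]
  rw [h', h]
  noncomm_ring

theorem scalarPart_oneAdd (a : Matrix (Fin n) (Fin n) A) (i j : Fin n) :
    Unit1.scalarPart A (oneAdd a i j) = (1 : Matrix (Fin n) (Fin n) ℂ) i j := by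
  simp [oneAdd, Matrix.one_apply, apply_ite (Unit1.scalarPart A)]

theorem snd_oneAdd (a : Matrix (Fin n) (Fin n) A) (i j : Fin n) :
    Unit1.snd A (oneAdd a i j) = a i j := by
  simp [oneAdd, Matrix.one_apply, apply_ite (Unit1.snd A)]

theorem oneAdd_injective :
    Function.Injective (oneAdd : Matrix (Fin n) (Fin n) A → Matrix (Fin n) (Fin n) (Unit1 A)) := by
  intro a b h
  ext i j
  rw [← snd_oneAdd a, h, snd_oneAdd]

theorem continuous_oneAdd :
    Continuous (oneAdd : Matrix (Fin n) (Fin n) A → Matrix (Fin n) (Fin n) (Unit1 A)) :=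
  continuous_const.add (continuous_id.matrix_map (Unit1.inr A).continuous)

theorem mem_GLnSubgroup {u : (Matrix (Fin n) (Fin n) (Unit1 A))ˣ}
    {a : Matrix (Fin n) (Fin n) A} (h : (u : Matrix (Fin n) (Fin n) (Unit1 A)) = oneAdd a) :
    u ∈ GLnSubgroup A n := by
  rw [GLnSubgroup, MonoidHom.mem_ker]
  ext i j
  refine Eq.trans ?_ (scalarPart_oneAdd a i j)
  rw [← h]
  rfl

/-- The matrix `a` over `A` such that `S = 1 + a`. -/
def GLn.coeff (S : GLn A n) : Matrix (Fin n) (Fin n) A :=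
  Matrix.of fun i j ↦ Unit1.snd A ((S : (Matrix (Fin n) (Fin n) (Unit1 A))ˣ).val i j)

theorem GLn.oneAdd_coeff (S : GLn A n) :
    oneAdd S.coeff = (S : (Matrix (Fin n) (Fin n) (Unit1 A))ˣ).val := by
  obtain ⟨S, hS⟩ := S
  rw [GLnSubgroup, MonoidHom.mem_ker] at hS
  ext1 i j
  refine Unit1.ext ?_ (snd_oneAdd _ _ _)
  rw [scalarPart_oneAdd]
  exact (congrArg (fun u : (Matrix (Fin n) (Fin n) ℂ)ˣ ↦
    (u : Matrix (Fin n) (Fin n) ℂ) i j) hS).symm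

theorem GLn.coeff_injective :
    Function.Injective (GLn.coeff : GLn A n → Matrix (Fin n) (Fin n) A) := by
  intro S T h
  apply Subtype.ext
  apply Units.ext
  rw [← GLn.oneAdd_coeff, h, GLn.oneAdd_coeff]

theorem GLn.coeff_mul (S T : GLn A n) :
    (S * T).coeff = S.coeff + T.coeff + S.coeff * T.coeff := by
  apply oneAdd_injective
  rw [← oneAdd_mul]
  simp only [GLn.oneAdd_coeff]
  rfl

@[simp]
theorem GLn.coeff_one : (1 : GLn A n).coeff = 0 := by
  apply oneAdd_injective
  rw [GLn.oneAdd_coeff, oneAdd_zero]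
  rfl

theorem GLn.coeff_map (f : A →ₙₐ[ℂ] B) (S : GLn A n) :
    (GLn.map n f S).coeff = S.coeff.map f := by
  ext i j
  exact Unit1.snd_map f _

/-- A matrix `a` for which `1 + a` is invertible is the coefficient matrix of an element of
`GL_n(A)`. -/
theorem GLn.exists_coeff_eq {a a' : Matrix (Fin n) (Fin n) A} (h : a + a' + a * a' = 0)
    (h' : a' + a + a' * a = 0) : ∃ S : GLn A n, S.coeff = a := by
  refine ⟨⟨⟨oneAdd a, oneAdd a', ?_, ?_⟩, mem_GLnSubgroup (a := a) rfl⟩, ?_⟩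
  · rw [oneAdd_mul, h, oneAdd_zero]
  · rw [oneAdd_mul, h', oneAdd_zero]
  · ext i j
    exact snd_oneAdd a i j

/-- The operator norm on matrices is an auxiliary choice: its uniformity is the entrywise one, so
results proved with it concern the product topology. -/
theorem completeSpace_matrix (R : Type*) [NormedRing R] [CompleteSpace R] (n : ℕ) :
    @CompleteSpace (Matrix (Fin n) (Fin n) R)
      (Matrix.linftyOpNormedRing (n := Fin n) (α := R)).toUniformSpace :=
  inferInstanceAs (CompleteSpace (Fin n → Fin n → R))

theorem isOpenEmbedding_unitsVal (R : Type*) [NormedRing R] [CompleteSpace R] (n : ℕ) :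
    IsOpenEmbedding (Units.val : (Matrix (Fin n) (Fin n) R)ˣ → Matrix (Fin n) (Fin n) R) := by
  let _ : NormedRing (Matrix (Fin n) (Fin n) R) := Matrix.linftyOpNormedRing
  have := completeSpace_matrix R n
  exact Units.isOpenEmbedding_val (R := Matrix (Fin n) (Fin n) R)

theorem GLn.continuous_coeff :
    Continuous (GLn.coeff : GLn A n → Matrix (Fin n) (Fin n) A) :=
  (Units.continuous_val.comp continuous_subtype_val).matrix_map (Unit1.snd A).continuous

variable [CompleteSpace A]

/-- Over a complete algebra inversion is continuous, so the unit group carries the subspace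
topology. Continuity of maps into GL_n can thus be tested on coefficients. -/
theorem GLn.isEmbedding_coeff :
    IsEmbedding (GLn.coeff : GLn A n → Matrix (Fin n) (Fin n) A) := by
  refine IsEmbedding.of_comp GLn.continuous_coeff continuous_oneAdd ?_
  have h : oneAdd ∘ GLn.coeff = Units.val ∘
      (Subtype.val : GLn A n → (Matrix (Fin n) (Fin n) (Unit1 A))ˣ) :=
    funext fun S ↦ GLn.oneAdd_coeff S
  rw [h]
  exact (isOpenEmbedding_unitsVal _ n).isEmbedding.comp IsEmbedding.subtypeVal

theorem GLn.range_coeff_mem_nhds :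
    Set.range (GLn.coeff : GLn A n → Matrix (Fin n) (Fin n) A) ∈ 𝓝 0 := by
  have h := continuous_oneAdd.continuousAt.preimage_mem_nhds (x := (0 : Matrix (Fin n) (Fin n) A))
    ((isOpenEmbedding_unitsVal (Unit1 A) n).isOpen_range.mem_nhds
      (by rw [oneAdd_zero]; exact ⟨1, rfl⟩))
  filter_upwards [h] with a ⟨u, hu⟩
  refine ⟨⟨u, mem_GLnSubgroup hu⟩, ?_⟩
  apply oneAdd_injective
  rw [GLn.oneAdd_coeff]
  exact hu

omit [CompleteSpace A] in
theorem GLn.continuous_map [CompleteSpace B] {f : A →ₙₐ[ℂ] B} (hf : Continuous f) :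
    Continuous (GLn.map n f) := by
  rw [GLn.isEmbedding_coeff.continuous_iff]
  have h : GLn.coeff ∘ GLn.map n f = fun S : GLn A n ↦ S.coeff.map f :=
    funext fun S ↦ GLn.coeff_map f S
  rw [h]
  exact GLn.continuous_coeff.matrix_map hf

end Coefficients

/-! ### Continuous solutions of linear equations between Banach spaces. -/

section Selection

variable {Y Z : Type*} [NormedAddCommGroup Y] [NormedSpace ℝ Y] [CompleteSpace Y]
  [NormedAddCommGroup Z] [NormedSpace ℝ Z]

/-- A surjective continuous linear map between Banach spaces has a continuous approximate right
inverse of linear growth. -/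
theorem exists_continuous_approx_rightInverse [CompleteSpace Z] (L : Y →L[ℝ] Z)
    (hL : Function.Surjective L) :
    ∃ (σ : Z → Y) (K : ℝ), 0 < K ∧ Continuous σ ∧ (∀ z, ‖σ z‖ ≤ K * ‖z‖) ∧
      ∀ z, ‖L (σ z) - z‖ ≤ 1 / 4 * ‖z‖ := by
  obtain ⟨C, hC, hpre⟩ := L.exists_preimage_norm_le hL
  -- A preimage of z of norm at most C‖z‖ satisfies both constraints strictly, so it still satisfies
  -- them for w near z. The constraints being convex, a partition of unity glues these local
  -- choices. At z = 0 there is no slack, hence its exclusion.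
  let t : {z : Z // z ≠ 0} → Set Y := fun z ↦
    {y | ‖y‖ ≤ 2 * C * ‖(z : Z)‖} ∩ {y | ‖L y - z‖ ≤ 1 / 4 * ‖(z : Z)‖}
  have ht : ∀ z, Convex ℝ (t z) := by
    intro z
    refine Convex.inter ?_ ?_
    · simpa [Metric.closedBall, dist_eq_norm] using
        convex_closedBall (0 : Y) (2 * C * ‖(z : Z)‖)
    · have h := (convex_closedBall (z : Z) (1 / 4 * ‖(z : Z)‖)).is_linear_preimage
        (f := L) L.toLinearMap.isLinear
      simpa [Metric.closedBall, dist_eq_norm, Set.preimage] using h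
  have hloc : ∀ z, ∃ y, ∀ᶠ w in 𝓝 z, y ∈ t w := by
    intro z
    obtain ⟨y, hy, hyz⟩ := hpre z
    have hz : 0 < ‖(z : Z)‖ := norm_pos_iff.2 z.2
    refine ⟨y, Filter.Eventually.and ?_ ?_⟩
    · have h : ‖y‖ < 2 * C * ‖(z : Z)‖ := by nlinarith [mul_pos hC hz]
      have hc : Continuous fun w : {z : Z // z ≠ 0} ↦ 2 * C * ‖(w : Z)‖ := by fun_prop
      filter_upwards [hc.continuousAt.eventually (lt_mem_nhds h)] with w hw using hw.le
    · have h : ‖L y - z‖ < 1 / 4 * ‖(z : Z)‖ := by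
        rw [hy, sub_self, norm_zero]
        positivity
      have hc : Continuous fun w : {z : Z // z ≠ 0} ↦ 1 / 4 * ‖(w : Z)‖ - ‖L y - w‖ := by fun_prop
      filter_upwards [hc.continuousAt.eventually (lt_mem_nhds (sub_pos.2 h))] with w hw
        using (sub_pos.1 hw).le
  obtain ⟨g, hg⟩ := exists_continuous_forall_mem_convex_of_local_const ht hloc
  classical
  -- The value 0 at the origin is continuous because of the linear bound on σ.
  let σ : Z → Y := fun z ↦ if h : z ≠ 0 then g ⟨z, h⟩ else 0
  have hσ : ∀ z (h : z ≠ 0), σ z = g ⟨z, h⟩ := fun z h ↦ dif_pos h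
  have hσ0 : σ 0 = 0 := dif_neg (by simp)
  have hbound : ∀ z, ‖σ z‖ ≤ 2 * C * ‖z‖ := by
    intro z
    by_cases h : z = 0
    · simp [h, hσ0]
    · rw [hσ z h]
      exact (hg ⟨z, h⟩).1
  refine ⟨σ, 2 * C, by positivity, ?_, hbound, ?_⟩
  · rw [continuous_iff_continuousAt]
    intro z
    by_cases h : z = 0
    · subst h
      rw [ContinuousAt, hσ0]
      refine squeeze_zero_norm hbound ?_
      have hc : Continuous fun w : Z ↦ 2 * C * ‖w‖ := by fun_prop
      simpa using hc.tendsto 0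
    · have hopen : IsOpen {z : Z | z ≠ 0} := isOpen_ne
      have hcont : ContinuousOn σ {z : Z | z ≠ 0} := by
        rw [continuousOn_iff_continuous_domRestrict]
        have he : Set.domRestrict {z : Z | z ≠ 0} σ = g := funext fun z ↦ hσ z z.2
        rw [he]
        exact g.continuous
      exact hcont.continuousAt (hopen.mem_nhds h)
  · intro z
    by_cases h : z = 0
    · simp [h, hσ0]
    · rw [hσ z h]
      exact (hg ⟨z, h⟩).2

/-- A family of linear equations `L x y = r x` has a solution that depends continuously on the
parameter `x`, if the maps `L x` have a common continuous approximate right inverse. -/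
theorem exists_continuous_solution {X : Type*} [TopologicalSpace X] (L : X → Y →L[ℝ] Z)
    (hL : Continuous fun p : X × Y ↦ L p.1 p.2) {σ : Z → Y} {K : ℝ} (hK : 0 < K)
    (hσ : Continuous σ) (hσK : ∀ z, ‖σ z‖ ≤ K * ‖z‖)
    (hLσ : ∀ x z, ‖L x (σ z) - z‖ ≤ 1 / 2 * ‖z‖) {r : X → Z} (hr : Continuous r) {M : ℝ}
    (hrM : ∀ x, ‖r x‖ ≤ M) :
    ∃ y : X → Y, Continuous y ∧ (∀ x, L x (y x) = r x) ∧ ∀ x, ‖y x‖ ≤ 2 * K * ‖r x‖ := by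
  -- Residuals of successive approximation: each correction by σ at least halves the norm, and the
  -- solution is the sum of the corrections.
  let ρ : ℕ → X → Z := fun k ↦ Nat.rec r (fun _ s x ↦ s x - L x (σ (s x))) k
  have hρs : ∀ k x, ρ (k + 1) x = ρ k x - L x (σ (ρ k x)) := fun _ _ ↦ rfl
  have hρc : ∀ k, Continuous (ρ k) := by
    intro k
    induction k with
    | zero => exact hr
    | succ k ih => exact ih.sub (hL.comp (continuous_id.prodMk (hσ.comp ih)))
  have hρ : ∀ k x, ‖ρ k x‖ ≤ (1 / 2) ^ k * ‖r x‖ := by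
    intro k x
    induction k with
    | zero => simp [ρ]
    | succ k ih =>
      rw [hρs, norm_sub_rev]
      refine (hLσ x _).trans ?_
      rw [pow_succ']
      linarith
  have hterm : ∀ k x, ‖σ (ρ k x)‖ ≤ K * ‖r x‖ * (1 / 2) ^ k := fun k x ↦
    (hσK _).trans (by nlinarith [mul_le_mul_of_nonneg_left (hρ k x) hK.le])
  have hgeom : ∀ c : ℝ, HasSum (fun k : ℕ ↦ c * (1 / 2) ^ k) (c * 2) := fun c ↦
    hasSum_geometric_two.mul_left c
  have hsummable : ∀ x, Summable fun k ↦ σ (ρ k x) := fun x ↦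
    Summable.of_norm_bounded (hgeom (K * ‖r x‖)).summable fun k ↦ hterm k x
  refine ⟨fun x ↦ ∑' k, σ (ρ k x), ?_, ?_, ?_⟩
  -- The uniform bound M serves only here, for the Weierstrass test.
  · refine continuous_tsum (fun k ↦ hσ.comp (hρc k)) (hgeom (K * M)).summable fun k x ↦ ?_
    refine (hterm k x).trans ?_
    have := mul_le_mul_of_nonneg_left (hrM x) hK.le
    gcongr
  · intro x
    have h1 := ((hsummable x).hasSum.mapL (L x)).tendsto_sum_nat
    have h2 : ∀ N, ∑ k ∈ Finset.range N, L x (σ (ρ k x)) = r x - ρ N x := by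
      intro N
      induction N with
      | zero => simp [ρ]
      | succ N ih =>
        rw [Finset.sum_range_succ, ih, hρs]
        abel
    simp only [h2] at h1
    have h3 : Filter.Tendsto (fun N ↦ ρ N x) Filter.atTop (𝓝 0) := by
      refine squeeze_zero_norm (fun N ↦ hρ N x) ?_
      simpa using (tendsto_pow_atTop_nhds_zero_of_lt_one (r := (1 / 2 : ℝ)) (by norm_num)
        (by norm_num)).mul_const ‖r x‖
    have h4 := tendsto_const_nhds (x := r x).sub h3
    rw [sub_zero] at h4
    exact tendsto_nhds_unique h1 h4
  · intro x
    refine (tsum_of_norm_bounded (hgeom (K * ‖r x‖)) fun k ↦ hterm k x).trans (le_of_eq ?_)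
    ring

/-- If the linear maps `L d` depend continuously on `d` and `L 0` is surjective, then the equations
`L d y = d` have, for small `d`, a solution `y` that is continuous in `d`. -/
theorem exists_continuous_solution_near_zero [CompleteSpace Z] (L : Z → Y →L[ℝ] Z)
    (hL : Continuous fun p : Z × Y ↦ L p.1 p.2) (hsurj : Function.Surjective (L 0)) {Q : ℝ}
    (hQ0 : 0 ≤ Q) (hQ : ∀ d y, ‖L d y - L 0 y‖ ≤ Q * (‖y‖ * ‖d‖)) :
    ∃ δ > 0, ∃ K > 0, ∃ y : Metric.ball (0 : Z) δ → Y,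
      Continuous y ∧ (∀ d : Metric.ball (0 : Z) δ, L d (y d) = d) ∧
        ∀ d, ‖y d‖ ≤ K * ‖(d : Z)‖ := by
  obtain ⟨σ, K, hK, hσ, hσK, hLσ⟩ := exists_continuous_approx_rightInverse _ hsurj
  -- The summand 1 keeps P positive when Q = 0. On the ball of radius 1 / (4P) the perturbation of L
  -- 0 costs at most 1/4, which with the 1/4 of σ gives the required 1/2.
  let P : ℝ := 1 + Q * K
  have hP : 0 < P := by positivity
  let X := Metric.ball (0 : Z) (1 / (4 * P))
  have hX : ∀ d : X, ‖(d : Z)‖ ≤ 1 / (4 * P) :=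
    fun d ↦ (mem_ball_zero_iff.1 d.2).le
  have happrox : ∀ (d : X) z, ‖L d (σ z) - z‖ ≤ 1 / 2 * ‖z‖ := by
    intro d z
    have h1 := hQ d (σ z)
    have h2 := hLσ z
    have h5 : Q * (‖σ z‖ * ‖(d : Z)‖) ≤ 1 / 4 * ‖z‖ := by
      calc Q * (‖σ z‖ * ‖(d : Z)‖)
          ≤ Q * ((K * ‖z‖) * (1 / (4 * P))) := by
            gcongr
            · exact hσK z
            · exact hX d
        _ = (Q * K) * (1 / (4 * P)) * ‖z‖ := by ring
        _ ≤ P * (1 / (4 * P)) * ‖z‖ := by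
            gcongr
            exact le_add_of_nonneg_left zero_le_one
        _ = 1 / 4 * ‖z‖ := by
            field_simp
    have h6 := norm_add_le (L d (σ z) - L 0 (σ z)) (L 0 (σ z) - z)
    rw [sub_add_sub_cancel] at h6
    linarith
  obtain ⟨y, hyc, hy, hyn⟩ := exists_continuous_solution (fun d : X ↦ L d)
    (hL.comp ((continuous_subtype_val.comp continuous_fst).prodMk continuous_snd))
    hK hσ hσK happrox continuous_subtype_val hX
  exact ⟨1 / (4 * P), by positivity, 2 * K, by positivity, y, hyc, hy, hyn⟩

end Selection

/-! ### A continuous section of π near the identity. -/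

section LocalSection

variable {B C D : Type*}
  [NonUnitalNormedRing B] [NormedSpace ℂ B]
  [NonUnitalNormedRing C] [NormedSpace ℂ C]
  [NonUnitalNormedRing D] [NormedSpace ℂ D] [IsScalarTower ℂ D D] [SMulCommClass ℂ D D]
  {n : ℕ}

/-- The coordinate functional `b ↦ b i j`. -/
def matrixEntry {E : Type*} [NonUnitalNormedRing E] [NormedSpace ℂ E] (i j : Fin n) :
    (Fin n → Fin n → E) →L[ℂ] E :=
  (ContinuousLinearMap.proj j).comp
    (ContinuousLinearMap.proj (R := ℂ) (φ := fun _ : Fin n ↦ Fin n → E) i)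

/-- For a matrix `d` over `D`, the linear map `(b, c) ↦ ψ(c) - φ(b) (1 + d)` on matrices. -/
def twistedDiff (n : ℕ) (φ : B →L[ℂ] D) (ψ : C →L[ℂ] D) (d : Fin n → Fin n → D) :
    (Fin n → Fin n → B) × (Fin n → Fin n → C) →L[ℂ] (Fin n → Fin n → D) :=
  ContinuousLinearMap.pi fun i ↦ ContinuousLinearMap.pi fun j ↦
    ψ.comp ((matrixEntry i j).comp (ContinuousLinearMap.snd ℂ _ _))
      - φ.comp ((matrixEntry i j).comp (ContinuousLinearMap.fst ℂ _ _))
      - ∑ k, ((ContinuousLinearMap.mul ℂ D).flip (d k j)).comp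
          (φ.comp ((matrixEntry i k).comp (ContinuousLinearMap.fst ℂ _ _)))

theorem twistedDiff_apply (φ : B →L[ℂ] D) (ψ : C →L[ℂ] D) (d : Fin n → Fin n → D)
    (y : (Fin n → Fin n → B) × (Fin n → Fin n → C)) (i j : Fin n) :
    twistedDiff n φ ψ d y i j =
      ψ (y.2 i j) - φ (y.1 i j) - ∑ k, φ (y.1 i k) * d k j := by
  simp [twistedDiff, matrixEntry]

theorem continuous_twistedDiff (φ : B →L[ℂ] D) (ψ : C →L[ℂ] D) :
    Continuous fun p : (Fin n → Fin n → D) × ((Fin n → Fin n → B) × (Fin n → Fin n → C)) ↦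
      twistedDiff n φ ψ p.1 p.2 := by
  refine continuous_pi fun i ↦ continuous_pi fun j ↦ ?_
  simp only [twistedDiff_apply]
  have := φ.continuous
  have := ψ.continuous
  fun_prop

theorem norm_twistedDiff_sub_le (φ : B →L[ℂ] D) (ψ : C →L[ℂ] D) (d : Fin n → Fin n → D)
    (y : (Fin n → Fin n → B) × (Fin n → Fin n → C)) :
    ‖twistedDiff n φ ψ d y - twistedDiff n φ ψ 0 y‖ ≤ n * (‖φ‖ * ‖y‖ * ‖d‖) := by
  have h0 : 0 ≤ n * (‖φ‖ * ‖y‖ * ‖d‖) := by positivity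
  refine (pi_norm_le_iff_of_nonneg h0).2 fun i ↦ (pi_norm_le_iff_of_nonneg h0).2 fun j ↦ ?_
  have h : (twistedDiff n φ ψ d y - twistedDiff n φ ψ 0 y) i j =
      - ∑ k, φ (y.1 i k) * d k j := by
    simp [twistedDiff_apply]
  rw [h, norm_neg]
  refine (norm_sum_le _ _).trans ?_
  refine (Finset.sum_le_card_nsmul _ _ (‖φ‖ * ‖y‖ * ‖d‖) fun k _ ↦ ?_).trans (by simp)
  refine (norm_mul_le _ _).trans (mul_le_mul ?_ ?_ (norm_nonneg _) (by positivity))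
  · refine (φ.le_opNorm _).trans (mul_le_mul_of_nonneg_left ?_ (norm_nonneg _))
    exact (norm_le_pi_norm (y.1 i) k).trans ((norm_le_pi_norm y.1 i).trans (norm_fst_le y))
  · exact (norm_le_pi_norm (d k) j).trans (norm_le_pi_norm d k)

/-- For small `d`, the equation `ψ(c) - φ(b) (1 + d) = d` has a solution `(b, c)` that is
continuous in `d`. -/
theorem exists_continuous_twistedDiff_eq (n : ℕ) (φ : B →L[ℂ] D) (ψ : C →L[ℂ] D)
    [CompleteSpace B] [CompleteSpace C] [CompleteSpace D]
    (hsum : ∀ d : D, ∃ (b : B) (c : C), φ b + ψ c = d) :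
    ∃ δ > 0, ∃ K > 0, ∃ y : Metric.ball (0 : Fin n → Fin n → D) δ →
        (Fin n → Fin n → B) × (Fin n → Fin n → C),
      Continuous y ∧
      (∀ d : Metric.ball (0 : Fin n → Fin n → D) δ, twistedDiff n φ ψ d (y d) = d) ∧
        ∀ d, ‖y d‖ ≤ K * ‖(d : Fin n → Fin n → D)‖ := by
  have hsurj : Function.Surjective (twistedDiff n φ ψ 0) := by
    intro d
    choose b c h using fun i j ↦ hsum (d i j)
    refine ⟨(fun i j ↦ -b i j, c), ?_⟩
    ext i j
    rw [← h i j]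
    simp [twistedDiff_apply, add_comm]
  exact exists_continuous_solution_near_zero
    (fun d ↦ (twistedDiff n φ ψ d).restrictScalars ℝ) (continuous_twistedDiff φ ψ) hsurj
    (Q := n * ‖φ‖) (by positivity) fun d y ↦
      (norm_twistedDiff_sub_le φ ψ d y).trans (le_of_eq (by ring))

theorem exists_coeff_eq_of_norm_lt (n : ℕ) (B : Type*) [NonUnitalNormedRing B] [NormedSpace ℂ B]
    [IsScalarTower ℂ B B] [SMulCommClass ℂ B B] [CompleteSpace B] :
    ∃ ε > 0, ∀ b : Fin n → Fin n → B, ‖b‖ < ε → ∃ S : GLn B n, S.coeff = Matrix.of b := by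
  have h : Set.range (GLn.coeff : GLn B n → Matrix (Fin n) (Fin n) B) ∈
      𝓝 (0 : Fin n → Fin n → B) := GLn.range_coeff_mem_nhds
  obtain ⟨ε, hε, hball⟩ := Metric.mem_nhds_iff.1 h
  exact ⟨ε, hε, fun b hb ↦ hball (mem_ball_zero_iff.2 hb)⟩

variable [IsScalarTower ℂ B B] [SMulCommClass ℂ B B] [IsScalarTower ℂ C C] [SMulCommClass ℂ C C]

/-- This is ψ(T) = φ(S)W, expanded with S = 1 + b, T = 1 + c, W = 1 + d. -/
theorem quotientMap_eq_of_twistedDiff_eq {φ : B →ₙₐ[ℂ] D} {ψ : C →ₙₐ[ℂ] D}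
    (hφ : Continuous φ) (hψ : Continuous ψ) {S : GLn B n} {T : GLn C n} {W : GLn D n}
    (h : twistedDiff n ⟨(φ : B →ₗ[ℂ] D), hφ⟩ ⟨(ψ : C →ₗ[ℂ] D), hψ⟩ W.coeff (S.coeff, T.coeff) =
      W.coeff) : quotientMap n φ ψ (S, T) = W := by
  rw [quotientMap, inv_mul_eq_iff_eq_mul]
  apply GLn.coeff_injective
  rw [GLn.coeff_mul, GLn.coeff_map, GLn.coeff_map]
  ext i j
  have h := (twistedDiff_apply _ _ _ _ i j).symm.trans (congrFun (congrFun h i) j)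
  rw [sub_sub, sub_eq_iff_eq_add'] at h
  change ψ (T.coeff i j) = φ (S.coeff i j) + ∑ k, φ (S.coeff i k) * W.coeff k j + W.coeff i j at h
  simp only [Matrix.map_apply, Matrix.add_apply, Matrix.mul_apply]
  rw [h]
  abel

/-- Near the identity, `(S, T) ↦ φ(S)⁻¹ ψ(T)` has a continuous section. -/
theorem exists_section_near_one [CompleteSpace B] [CompleteSpace C]
    [CompleteSpace D] {φ : B →ₙₐ[ℂ] D} {ψ : C →ₙₐ[ℂ] D}
    (hφ : Continuous φ) (hψ : Continuous ψ) (hsum : ∀ d : D, ∃ (b : B) (c : C), φ b + ψ c = d) :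
    ∃ N : Set (GLn D n), IsOpen N ∧ 1 ∈ N ∧ ∃ s : N → GLn B n × GLn C n,
      Continuous s ∧ ∀ W : N, quotientMap n φ ψ (s W) = W := by
  obtain ⟨δ, hδ, K, hK, y, hyc, hy, hyn⟩ := exists_continuous_twistedDiff_eq n
    ⟨(φ : B →ₗ[ℂ] D), hφ⟩ ⟨(ψ : C →ₗ[ℂ] D), hψ⟩ hsum
  obtain ⟨ε₁, hε₁, hB⟩ := exists_coeff_eq_of_norm_lt n B
  obtain ⟨ε₂, hε₂, hC⟩ := exists_coeff_eq_of_norm_lt n C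
  let co : GLn D n → Fin n → Fin n → D := fun W ↦ W.coeff
  have hco : Continuous co := GLn.continuous_coeff
  have hco1 : co 1 = 0 := GLn.coeff_one
  -- The first bound puts d in the domain of the solution y; the second makes y(d) small enough for
  -- both 1 + b and 1 + c to be invertible.
  let N : Set (GLn D n) := {W | ‖co W‖ < δ} ∩ {W | K * ‖co W‖ < min ε₁ ε₂}
  let co' : N → Metric.ball (0 : Fin n → Fin n → D) δ :=
    fun W ↦ ⟨co W, mem_ball_zero_iff.2 W.2.1⟩
  have hco' : Continuous co' := (hco.comp continuous_subtype_val).subtype_mk _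
  have hsmall : ∀ W : N, ‖y (co' W)‖ < min ε₁ ε₂ := fun W ↦ (hyn _).trans_lt W.2.2
  choose S hS using fun W : N ↦ hB (y (co' W)).1
    ((norm_fst_le _).trans_lt ((hsmall W).trans_le (min_le_left _ _)))
  choose T hT using fun W : N ↦ hC (y (co' W)).2
    ((norm_snd_le _).trans_lt ((hsmall W).trans_le (min_le_right _ _)))
  refine ⟨N, ?_, ?_, fun W ↦ (S W, T W), Continuous.prodMk ?_ ?_, fun W ↦ ?_⟩
  · exact (isOpen_lt (by fun_prop) (by fun_prop)).inter (isOpen_lt (by fun_prop) (by fun_prop))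
  · exact ⟨by simpa [hco1] using hδ, by simp [hco1, hε₁, hε₂]⟩
  · rw [GLn.isEmbedding_coeff.continuous_iff]
    exact (continuous_fst.comp (hyc.comp hco')).congr fun W ↦ (hS W).symm
  · rw [GLn.isEmbedding_coeff.continuous_iff]
    exact (continuous_snd.comp (hyc.comp hco')).congr fun W ↦ (hT W).symm
  · apply quotientMap_eq_of_twistedDiff_eq hφ hψ
    rw [hS, hT]
    exact hy (co' W)

end LocalSection

/-! ### Exponentials of matrices. -/

section Exponential

theorem matrix_continuous_exp (R : Type*) [NormedRing R] [NormedAlgebra ℂ R] [CompleteSpace R]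
    (n : ℕ) : Continuous (NormedSpace.exp :
      Matrix (Fin n) (Fin n) R → Matrix (Fin n) (Fin n) R) := by
  let _ : NormedRing (Matrix (Fin n) (Fin n) R) := Matrix.linftyOpNormedRing
  let _ : NormedAlgebra ℂ (Matrix (Fin n) (Fin n) R) := Matrix.linftyOpNormedAlgebra
  let _ := NormedAlgebra.restrictScalars ℚ ℂ (Matrix (Fin n) (Fin n) R)
  have := completeSpace_matrix R n
  exact NormedSpace.exp_continuous (𝔸 := Matrix (Fin n) (Fin n) R)

theorem matrix_isUnit_exp {R : Type*} [NormedRing R] [NormedAlgebra ℂ R] [CompleteSpace R]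
    {n : ℕ} (x : Matrix (Fin n) (Fin n) R) : IsUnit (NormedSpace.exp x) := by
  let _ : NormedRing (Matrix (Fin n) (Fin n) R) := Matrix.linftyOpNormedRing
  let _ : NormedAlgebra ℂ (Matrix (Fin n) (Fin n) R) := Matrix.linftyOpNormedAlgebra
  let _ := NormedAlgebra.restrictScalars ℚ ℂ (Matrix (Fin n) (Fin n) R)
  have := completeSpace_matrix R n
  exact NormedSpace.isUnit_exp (𝔸 := Matrix (Fin n) (Fin n) R) x

theorem matrix_map_exp {R S : Type*} [NormedRing R] [NormedAlgebra ℂ R] [CompleteSpace R]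
    [NormedRing S] [NormedAlgebra ℂ S] {n : ℕ} (f : R →+* S) (hf : Continuous f)
    (x : Matrix (Fin n) (Fin n) R) :
    (NormedSpace.exp x).map f = NormedSpace.exp (x.map f) := by
  let _ : NormedRing (Matrix (Fin n) (Fin n) R) := Matrix.linftyOpNormedRing
  let _ : NormedAlgebra ℂ (Matrix (Fin n) (Fin n) R) := Matrix.linftyOpNormedAlgebra
  let _ := NormedAlgebra.restrictScalars ℚ ℂ (Matrix (Fin n) (Fin n) R)
  let _ : NormedRing (Matrix (Fin n) (Fin n) S) := Matrix.linftyOpNormedRing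
  let _ : NormedAlgebra ℂ (Matrix (Fin n) (Fin n) S) := Matrix.linftyOpNormedAlgebra
  let _ := NormedAlgebra.restrictScalars ℚ ℂ (Matrix (Fin n) (Fin n) S)
  have := completeSpace_matrix R n
  have hc : Continuous fun y : Matrix (Fin n) (Fin n) R ↦ y.map f := continuous_id.matrix_map hf
  exact NormedSpace.map_exp (𝔸 := Matrix (Fin n) (Fin n) R) (𝔹 := Matrix (Fin n) (Fin n) S)
    (f.mapMatrix : Matrix (Fin n) (Fin n) R →+* Matrix (Fin n) (Fin n) S) hc x

/-- The derivative of exp at 0 is the identity, so the composite has derivative s ∘ i = id there,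
and the inverse function theorem applies. -/
theorem map_nhds_zero_comp_exp_comp {R I : Type*} [NormedRing R] [NormedAlgebra ℂ R]
    [CompleteSpace R] [NormedAddCommGroup I] [NormedSpace ℂ I] [CompleteSpace I]
    (i : I →L[ℂ] R) (s : R →L[ℂ] I) (hs : ∀ a, s (i a) = a)
    (hs1 : s 1 = 0) : Filter.map (fun a ↦ s (NormedSpace.exp (i a))) (𝓝 0) = 𝓝 0 := by
  have h0 : HasStrictFDerivAt (NormedSpace.exp : R → R) (1 : R →L[ℂ] R) (i 0) := by
    rw [map_zero]
    exact hasStrictFDerivAt_exp_zero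
  have h1 : HasStrictFDerivAt (fun a ↦ s (NormedSpace.exp (i a)))
      ((ContinuousLinearEquiv.refl ℂ I : I ≃L[ℂ] I) : I →L[ℂ] I) 0 := by
    have h := s.hasStrictFDerivAt.comp (0 : I) (h0.comp (0 : I) i.hasStrictFDerivAt)
    convert h using 1
    ext a
    exact (hs a).symm
  have h2 := h1.map_nhds_eq_of_equiv
  simpa [hs1] using h2

theorem matrix_range_comp_exp_mem_nhds {R I : Type*} [NormedRing R] [NormedAlgebra ℂ R]
    [CompleteSpace R] [NormedAddCommGroup I] [NormedSpace ℂ I] [CompleteSpace I] (n : ℕ)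
    (i : I →L[ℂ] R) (s : R →L[ℂ] I) (hs : ∀ a, s (i a) = a) (hs1 : s 1 = 0) :
    Set.range (fun a : Matrix (Fin n) (Fin n) I ↦ (NormedSpace.exp (a.map i)).map s) ∈
      𝓝 (0 : Matrix (Fin n) (Fin n) I) := by
  let _ : NormedRing (Matrix (Fin n) (Fin n) R) := Matrix.linftyOpNormedRing
  let _ : NormedAlgebra ℂ (Matrix (Fin n) (Fin n) R) := Matrix.linftyOpNormedAlgebra
  have := completeSpace_matrix R n
  let i' : (Fin n → Fin n → I) →L[ℂ] Matrix (Fin n) (Fin n) R :=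
    { toFun := fun a ↦ (Matrix.of a).map i
      map_add' := fun a b ↦ by ext; simp
      map_smul' := fun z a ↦ by ext; simp
      cont := (continuous_id (X := Matrix (Fin n) (Fin n) I)).matrix_map i.continuous }
  let s' : Matrix (Fin n) (Fin n) R →L[ℂ] (Fin n → Fin n → I) :=
    { toFun := fun a ↦ a.map s
      map_add' := fun a b ↦ funext fun j ↦ funext fun k ↦ s.map_add (a j k) (b j k)
      map_smul' := fun z a ↦ funext fun j ↦ funext fun k ↦ s.map_smul z (a j k)
      cont := (continuous_id (X := Matrix (Fin n) (Fin n) R)).matrix_map s.continuous }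
  have hs' : ∀ a, s' (i' a) = a := fun a ↦ by
    ext j k
    exact hs _
  have hs1' : s' 1 = 0 := by
    ext j k
    change s ((1 : Matrix (Fin n) (Fin n) R) j k) = 0
    rw [Matrix.one_apply]
    split_ifs <;> simp [hs1]
  have h := map_nhds_zero_comp_exp_comp i' s' hs' hs1'
  have h2 : Set.range (fun a ↦ s' (NormedSpace.exp (i' a))) ∈ 𝓝 (0 : Fin n → Fin n → I) := by
    rw [← h]
    exact Filter.range_mem_map
  exact h2

end Exponential

/-! ### Dense morphisms and the closure of the induced image in GL_n. -/

section Density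

variable {A B : Type*}
  [NonUnitalNormedRing A] [NormedSpace ℂ A] [IsScalarTower ℂ A A] [SMulCommClass ℂ A A]
  [NonUnitalNormedRing B] [NormedSpace ℂ B] [IsScalarTower ℂ B B] [SMulCommClass ℂ B B]
  {n : ℕ}

theorem Unit1.continuous_scalarPart : Continuous (Unit1.scalarPart A) := by
  refine AddMonoidHomClass.continuous_of_bound (Unit1.scalarPart A) 1 fun x ↦ ?_
  rw [WithLp.unitization_norm_def, one_mul]
  exact le_add_of_nonneg_right (norm_nonneg _)

theorem Unit1.eq_algebraMap_add_inr (x : Unit1 A) :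
    x = algebraMap ℂ (Unit1 A) (Unit1.scalarPart A x) + Unit1.inr A (Unit1.snd A x) := by
  refine Unit1.ext ?_ ?_
  · simp
  · rw [map_add, Algebra.algebraMap_eq_smul_one, map_smul]
    simp

theorem Unit1.continuous_map {f : A →ₙₐ[ℂ] B} (hf : Continuous f) :
    Continuous (Unit1.map f) := by
  have h : ⇑(Unit1.map f) = fun x ↦ algebraMap ℂ (Unit1 B) (Unit1.scalarPart A x) +
      Unit1.inr B (f (Unit1.snd A x)) := by
    funext x
    rw [Unit1.eq_algebraMap_add_inr (Unit1.map f x), Unit1.scalarPart_map, Unit1.snd_map]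
  rw [h]
  exact ((continuous_algebraMap ℂ (Unit1 B)).comp Unit1.continuous_scalarPart).add
    ((Unit1.inr B).continuous.comp (hf.comp (Unit1.snd A).continuous))

theorem Unit1.map_inr (f : A →ₙₐ[ℂ] B) (a : A) :
    Unit1.map f (Unit1.inr A a) = Unit1.inr B (f a) :=
  Unit1.ext (by rw [Unit1.scalarPart_map, Unit1.scalarPart_inr, Unit1.scalarPart_inr])
    (by rw [Unit1.snd_map, Unit1.snd_inr, Unit1.snd_inr])

/-- The coefficient matrix of the exponential of a matrix over `A`. -/
def expCoeff (a : Matrix (Fin n) (Fin n) A) : Matrix (Fin n) (Fin n) A :=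
  (NormedSpace.exp (a.map (Unit1.inr A))).map (Unit1.snd A)

/-- The scalar part of the exponential is exp(0) = 1, since exp commutes with continuous ring
homomorphisms. -/
theorem oneAdd_expCoeff [CompleteSpace A] (a : Matrix (Fin n) (Fin n) A) :
    oneAdd (expCoeff a) = NormedSpace.exp (a.map (Unit1.inr A)) := by
  ext1 i j
  refine Unit1.ext ?_ (snd_oneAdd _ _ _)
  rw [scalarPart_oneAdd]
  have h := matrix_map_exp (Unit1.scalarPart A).toRingHom Unit1.continuous_scalarPart
    (a.map (Unit1.inr A))
  have h0 : (a.map (Unit1.inr A)).map (Unit1.scalarPart A).toRingHom = 0 := by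
    ext i j
    exact Unit1.scalarPart_inr (a i j)
  rw [h0, NormedSpace.exp_zero] at h
  exact (congrFun (congrFun h i) j).symm

theorem continuous_expCoeff [CompleteSpace A] :
    Continuous (expCoeff : Matrix (Fin n) (Fin n) A → Matrix (Fin n) (Fin n) A) :=
  ((matrix_continuous_exp (Unit1 A) n).comp
    (continuous_id.matrix_map (Unit1.inr A).continuous)).matrix_map (Unit1.snd A).continuous

theorem expCoeff_map [CompleteSpace A] {f : A →ₙₐ[ℂ] B} (hf : Continuous f)
    (a : Matrix (Fin n) (Fin n) A) : expCoeff (a.map f) = (expCoeff a).map f := by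
  have h := matrix_map_exp (Unit1.map f).toRingHom (Unit1.continuous_map hf)
    (a.map (Unit1.inr A))
  have h0 : (a.map (Unit1.inr A)).map (Unit1.map f).toRingHom = (a.map f).map (Unit1.inr B) := by
    ext1 i j
    exact Unit1.map_inr f (a i j)
  rw [h0] at h
  rw [expCoeff, ← h]
  ext i j
  exact Unit1.snd_map f _

/-- The reason for using exp in the density argument: approximating b by f(a) gives no control on
the norm of a, so 1 + a may fail to be invertible, whereas exp(a) never does. -/
theorem GLn.exists_coeff_eq_expCoeff [CompleteSpace A] (a : Matrix (Fin n) (Fin n) A) :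
    ∃ S : GLn A n, S.coeff = expCoeff a := by
  obtain ⟨u, hu⟩ := matrix_isUnit_exp (a.map (Unit1.inr A))
  rw [← oneAdd_expCoeff] at hu
  refine ⟨⟨u, mem_GLnSubgroup hu⟩, oneAdd_injective ?_⟩
  rw [GLn.oneAdd_coeff]
  exact hu

/-- If `f` has dense image, then the closure of the image of `GL_n(A)` in `GL_n(B)` is a
neighbourhood of the identity. -/
theorem GLn.closure_range_map_mem_nhds [CompleteSpace A] [CompleteSpace B] {f : A →ₙₐ[ℂ] B}
    (hf : Continuous f) (hd : DenseRange f) :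
    closure (Set.range (GLn.map n f)) ∈ 𝓝 1 := by
  choose E hE using GLn.exists_coeff_eq_expCoeff (A := B) (n := n)
  have hEc : Continuous E := by
    rw [GLn.isEmbedding_coeff.continuous_iff]
    exact continuous_expCoeff.congr fun b ↦ (hE b).symm
  have hdense : DenseRange fun a : Matrix (Fin n) (Fin n) A ↦ a.map f :=
    DenseRange.piMap fun _ : Fin n ↦ DenseRange.piMap fun _ : Fin n ↦ hd
  have hrange : Set.range (expCoeff : Matrix (Fin n) (Fin n) B → _) ∈ 𝓝 0 :=
    matrix_range_comp_exp_mem_nhds n (Unit1.inr B) (Unit1.snd B) Unit1.snd_inr Unit1.snd_one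
  have hpre := GLn.continuous_coeff.continuousAt.preimage_mem_nhds (x := (1 : GLn B n))
    (by rw [GLn.coeff_one]; exact hrange)
  filter_upwards [hpre] with W ⟨b, hb⟩
  have hW : W = E b := GLn.coeff_injective (by rw [hE, hb])
  rw [hW]
  -- exp(b) is a limit of elements exp(f(a)) = f(exp(a)).
  refine map_mem_closure hEc (hdense b) ?_
  rintro _ ⟨a, rfl⟩
  obtain ⟨S, hS⟩ := GLn.exists_coeff_eq_expCoeff a
  refine ⟨S, GLn.coeff_injective ?_⟩
  rw [hE, GLn.coeff_map, hS, expCoeff_map hf]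

end Density

end BanachAlg

/-! ### Homotopy lifting from local transport. -/

section HomotopyLifting

variable {E X Y : Type*} [TopologicalSpace E] [TopologicalSpace X]

/-- `p` has local transport over `U`: for `e` over `U` and `v ∈ U` there is a point over `v`, which
depends continuously on `(e, v)` and is `e` if `e` lies over `v`. -/
def HasTransportOn (p : E → X) (U : Set X) : Prop :=
  ∃ θ : {q : E × X // p q.1 ∈ U ∧ q.2 ∈ U} → E, Continuous θ ∧ (∀ q, p (θ q) = q.1.2) ∧
    ∀ q, p q.1.1 = q.1.2 → θ q = q.1.1

/-- A lift, with initial value `f`, of the homotopy `H` stopped at the time `a`. -/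
def HasStoppedLift [TopologicalSpace Y] (p : E → X) (f : Y → E) (H : ℝ × Y → X) (a : Y → ℝ) :
    Prop :=
  ∃ K : ℝ × Y → E, Continuous K ∧ (∀ y, K (0, y) = f y) ∧
    ∀ t y, p (K (t, y)) = H (min t (a y), y)

/-- After time a(y) the old lift lies over H(a(y), y). Transport pushes it on to H(min(t, b(y)), y),
and is needed only over F, where the stopping time really increases. -/
theorem HasStoppedLift.extend [TopologicalSpace Y] {p : E → X} {f : Y → E} {H : ℝ × Y → X}
    {a b : Y → ℝ} (hlift : HasStoppedLift p f H a) (hH : Continuous H) (ha : Continuous a)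
    (hb : Continuous b) (ha0 : ∀ y, 0 ≤ a y) (hab : ∀ y, a y ≤ b y) {F : Set Y} (hF : IsClosed F)
    (habF : ∀ y, a y < b y → y ∈ F) {U : Set X} (hU : HasTransportOn p U)
    (hHU : ∀ y ∈ F, ∀ t ∈ Set.Icc (a y) (b y), H (t, y) ∈ U) : HasStoppedLift p f H b := by
  obtain ⟨K, hK, hK0, hKp⟩ := hlift
  obtain ⟨θ, hθ, hθp, hθe⟩ := hU
  -- The new lift is the transported one on P and the old one on Q. These closed sets cover
  -- everything, and on the overlap the two agree because θ fixes e when e already lies over the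
  -- target.
  let P : Set (ℝ × Y) := {z | a z.2 ≤ z.1} ∩ Prod.snd ⁻¹' F
  let Q : Set (ℝ × Y) := {z | z.1 ≤ a z.2} ∪ {z | a z.2 = b z.2}
  have hP : IsClosed P := IsClosed.inter (isClosed_le (by fun_prop) (by fun_prop))
    (hF.preimage continuous_snd)
  have hQ : IsClosed Q := IsClosed.union (isClosed_le (by fun_prop) (by fun_prop))
    (isClosed_eq (by fun_prop) (by fun_prop))
  have hmem : ∀ z : P, p (K z) ∈ U ∧
      H (min (z : ℝ × Y).1 (b (z : ℝ × Y).2), (z : ℝ × Y).2) ∈ U := by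
    rintro ⟨⟨t, y⟩, hat, hy⟩
    constructor
    · rw [hKp]
      exact hHU y hy _ ⟨le_min hat le_rfl, (min_le_right _ _).trans (hab y)⟩
    · exact hHU y hy _ ⟨le_min hat (hab y), min_le_right _ _⟩
  let G : P → E := fun z ↦
    θ ⟨(K z, H (min (z : ℝ × Y).1 (b (z : ℝ × Y).2), (z : ℝ × Y).2)), hmem z⟩
  have hG : Continuous G := by
    refine hθ.comp (Continuous.subtype_mk ?_ _)
    exact (hK.comp continuous_subtype_val).prodMk (hH.comp (by fun_prop))
  classical
  let K' : ℝ × Y → E := fun z ↦ if h : z ∈ P then G ⟨z, h⟩ else K z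
  have hKP : ∀ z (h : z ∈ P), K' z = G ⟨z, h⟩ := fun z h ↦ dif_pos h
  have hmin_eq : ∀ z ∈ Q, min z.1 (b z.2) = min z.1 (a z.2) := by
    rintro ⟨t, y⟩ (h | h)
    · simp only [Set.mem_ofPred_eq] at h ⊢
      rw [min_eq_left h, min_eq_left (h.trans (hab y))]
    · simp only [Set.mem_ofPred_eq] at h ⊢
      rw [h]
  have hKQ : ∀ z ∈ Q, K' z = K z := by
    intro z hz
    by_cases h : z ∈ P
    · rw [hKP z h]
      refine hθe _ ?_
      change p (K z) = H (min z.1 (b z.2), z.2)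
      rw [hmin_eq z hz]
      exact hKp z.1 z.2
    · exact dif_neg h
  have hPQ : ∀ z, z ∉ P → z ∈ Q := by
    intro z hz
    by_contra hz'
    simp only [Q, Set.mem_union, Set.mem_ofPred_eq, not_or, not_le] at hz'
    exact hz ⟨hz'.1.le, habF _ (lt_of_le_of_ne (hab _) hz'.2)⟩
  refine ⟨K', ?_, fun y ↦ ?_, fun t y ↦ ?_⟩
  · rw [← continuousOn_univ]
    have hun : (Set.univ : Set (ℝ × Y)) = P ∪ Q :=
      (Set.eq_univ_of_forall fun z ↦ or_iff_not_imp_left.2 (hPQ z)).symm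
    rw [hun]
    refine ContinuousOn.union_of_isClosed ?_ (hK.continuousOn.congr hKQ) hP hQ
    rw [continuousOn_iff_continuous_domRestrict]
    exact hG.congr fun z ↦ (hKP z z.2).symm
  · rw [hKQ _ (Or.inl (ha0 y)), hK0]
  · by_cases h : (t, y) ∈ P
    · rw [hKP _ h]
      exact hθp _
    · rw [hKQ _ (hPQ _ h), hKp]
      have := hmin_eq _ (hPQ _ h)
      simp only at this
      rw [this]

/-- A stopped lift can be prolonged by a time step during which, locally over the compact parameter
space, the homotopy moves in sets over which there is transport. -/
theorem HasStoppedLift.step [PseudoMetricSpace Y] [CompactSpace Y] {p : E → X} {f : Y → E}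
    {H : ℝ × Y → X} (hH : Continuous H) {t₀ t₁ r : ℝ} (ht₀ : 0 ≤ t₀) (ht : t₀ ≤ t₁) (hr : 0 < r)
    (hU : ∀ y₀, ∃ U, HasTransportOn p U ∧
      ∀ y ∈ Metric.closedBall y₀ r, ∀ t ∈ Set.Icc t₀ t₁, H (t, y) ∈ U)
    (hlift : HasStoppedLift p f H fun _ ↦ t₀) : HasStoppedLift p f H fun _ ↦ t₁ := by
  -- The stopping time is raised from t₀ to t₁ one ball at a time, so in between it must depend on
  -- y.
  have key : ∀ s : Finset Y, ∃ a : Y → ℝ, Continuous a ∧ (∀ y, t₀ ≤ a y) ∧ (∀ y, a y ≤ t₁) ∧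
      HasStoppedLift p f H a ∧ ∀ y₀ ∈ s, ∀ y ∈ Metric.ball y₀ (r / 2), t₁ ≤ a y := by
    classical
    intro s
    induction s using Finset.induction_on with
    | empty => exact ⟨fun _ ↦ t₀, continuous_const, fun _ ↦ le_rfl, fun _ ↦ ht, hlift, by simp⟩
    | insert y₀ s _ ih =>
      obtain ⟨a, ha, ha₀, ha₁, hal, has⟩ := ih
      obtain ⟨U, hUt, hUH⟩ := hU y₀
      -- A bump equal to 1 on the ball of radius r / 2 and 0 outside the ball of radius r.
      let β : Y → ℝ := fun y ↦ min 1 (max 0 (2 - 2 / r * dist y y₀))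
      have hβc : Continuous β := by fun_prop
      have hβ0 : ∀ y, 0 ≤ β y := fun y ↦ le_min zero_le_one (le_max_left _ _)
      have hβ1 : ∀ y, β y ≤ 1 := fun y ↦ min_le_left _ _
      let c : Y → ℝ := fun y ↦ t₀ + (t₁ - t₀) * β y
      have hc : Continuous c := by fun_prop
      have hc₁ : ∀ y, c y ≤ t₁ := fun y ↦ by
        have := mul_le_mul_of_nonneg_left (hβ1 y) (sub_nonneg.2 ht)
        simp only [c]
        linarith
      refine ⟨fun y ↦ max (a y) (c y), ha.max hc, fun y ↦ (ha₀ y).trans (le_max_left _ _),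
        fun y ↦ max_le (ha₁ y) (hc₁ y), ?_, ?_⟩
      · refine hal.extend hH ha (ha.max hc) (fun y ↦ ht₀.trans (ha₀ y)) (fun y ↦ le_max_left _ _)
          (Metric.isClosed_closedBall (x := y₀) (ε := r)) ?_ hUt ?_
        · intro y hy
          have h1 : a y < c y := (lt_max_iff.1 hy).resolve_left (lt_irrefl _)
          by_contra hyr
          rw [Metric.mem_closedBall, not_le] at hyr
          have h2 : 2 - 2 / r * dist y y₀ ≤ 0 := by
            have : 2 / r * r ≤ 2 / r * dist y y₀ := by gcongr
            rw [div_mul_cancel₀ _ hr.ne'] at this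
            linarith
          have h3 : β y = 0 := by simp [β, max_eq_left h2]
          have h4 := ha₀ y
          simp only [c, h3] at h1
          linarith
        · intro y hy t hty
          exact hUH y hy t ⟨(ha₀ y).trans hty.1, hty.2.trans (max_le (ha₁ y) (hc₁ y))⟩
      · intro y₁ hy₁ y hy
        rcases Finset.mem_insert.1 hy₁ with rfl | hy₁
        · refine le_trans (le_of_eq ?_) (le_max_right _ _)
          have h1 : 1 ≤ 2 - 2 / r * dist y y₁ := by
            have : 2 / r * dist y y₁ ≤ 2 / r * (r / 2) := by
              gcongr
              exact (Metric.mem_ball.1 hy).le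
            have h2 : 2 / r * (r / 2) = 1 := by field_simp
            linarith
          have h3 : β y = 1 := by
            simp only [β]
            rw [max_eq_right (zero_le_one.trans h1), min_eq_left h1]
          simp only [c, h3]
          ring
        · exact (has y₁ hy₁ y hy).trans (le_max_left _ _)
  obtain ⟨s, -, hsf, hs⟩ :=
    finite_cover_balls_of_compact (isCompact_univ (X := Y)) (half_pos hr)
  obtain ⟨a, -, -, ha₁, hal, has⟩ := key hsf.toFinset
  have : a = fun _ ↦ t₁ := by
    funext y
    obtain ⟨y₀, hy₀, hy⟩ := Set.mem_iUnion₂.1 (hs (Set.mem_univ y))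
    exact le_antisymm (ha₁ y) (has y₀ (hsf.mem_toFinset.2 hy₀) y hy)
  rwa [← this]

/-- A continuous map with local transport has the homotopy lifting property for compact metric
spaces. -/
theorem exists_homotopy_lift_of_transport [PseudoMetricSpace Y] [CompactSpace Y] {p : E → X}
    (hp : ∀ x, ∃ U, IsOpen U ∧ x ∈ U ∧ HasTransportOn p U) {f : Y → E}
    {H : unitInterval × Y → X} (hf : Continuous f) (hH : Continuous H)
    (h0 : ∀ y, H (0, y) = p (f y)) :
    ∃ K : unitInterval × Y → E, Continuous K ∧ (∀ y, K (0, y) = f y) ∧ ∀ z, p (K z) = H z := by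
  let H' : ℝ × Y → X := fun z ↦ H (Set.projIcc 0 1 zero_le_one z.1, z.2)
  have hH' : Continuous H' := hH.comp ((continuous_projIcc.comp continuous_fst).prodMk
    continuous_snd)
  choose U hUo hxU hU using hp
  -- With a Lebesgue number δ, time steps 1 / (m + 1) < δ and balls of radius δ / 2 in Y keep H
  -- inside one set with transport.
  obtain ⟨δ, hδ, hball⟩ := lebesgue_number_lemma_of_metric
    ((isCompact_Icc (a := (0 : ℝ)) (b := 1)).prod (isCompact_univ (X := Y)))
    (fun x ↦ (hUo x).preimage hH') (fun z _ ↦ Set.mem_iUnion.2 ⟨H' z, hxU _⟩)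
  obtain ⟨m, hm⟩ := exists_nat_one_div_lt hδ
  have hm0 : (0 : ℝ) < m + 1 := by positivity
  have key : ∀ j : ℕ, j ≤ m + 1 → HasStoppedLift p f H' fun _ ↦ (j : ℝ) / (m + 1) := by
    intro j
    induction j with
    | zero =>
      refine fun _ ↦ ⟨fun z ↦ f z.2, hf.comp continuous_snd, fun _ ↦ rfl, fun t y ↦ ?_⟩
      rw [← h0]
      change _ = H (Set.projIcc 0 1 zero_le_one _, y)
      rw [Set.projIcc_of_le_left zero_le_one (by simp)]
      rfl
    | succ j ih =>
      intro hj
      have hstep : ((j + 1 : ℕ) : ℝ) / (m + 1) = j / (m + 1) + 1 / (m + 1) := by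
        push_cast
        ring
      have hj1 : (j : ℝ) / (m + 1) ≤ 1 := by
        rw [div_le_one hm0]
        exact_mod_cast (Nat.le_succ j).trans hj
      have hj0 : 0 ≤ (j : ℝ) / (m + 1) := by positivity
      refine HasStoppedLift.step hH' hj0 ?_ (half_pos hδ) ?_ (ih ((Nat.le_succ j).trans hj))
      · rw [hstep]
        exact le_add_of_nonneg_right (by positivity)
      · intro y₀
        obtain ⟨x, hx⟩ := hball ((j : ℝ) / (m + 1), y₀) ⟨⟨hj0, hj1⟩, Set.mem_univ _⟩
        refine ⟨U x, hU x, fun y hy t ht ↦ hx ?_⟩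
        rw [Metric.mem_ball, Prod.dist_eq]
        refine max_lt ?_ ((Metric.mem_closedBall.1 hy).trans_lt (half_lt_self hδ))
        rw [Real.dist_eq, abs_of_nonneg (sub_nonneg.2 ht.1)]
        have := ht.2
        rw [hstep] at this
        linarith
  obtain ⟨K, hK, hK0, hKp⟩ := key (m + 1) le_rfl
  refine ⟨fun z ↦ K (z.1, z.2), hK.comp (by fun_prop), fun y ↦ hK0 y, fun z ↦ ?_⟩
  rw [hKp]
  have h1 : ((m + 1 : ℕ) : ℝ) / (m + 1) = 1 := by
    push_cast
    exact div_self hm0.ne'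
  rw [h1, min_eq_left z.1.2.2]
  change H (Set.projIcc 0 1 zero_le_one (z.1 : ℝ), z.2) = H z
  rw [Set.projIcc_val]

end HomotopyLifting

/-! ### The map (S, T) ↦ f(S)⁻¹ g(T) for topological groups. -/

section TopologicalGroups

variable {Q G H L : Type*} [Group Q] [Group G] [Group H] [Group L]

/-- The map `(S, T) ↦ f(S)⁻¹ g(T)`. -/
def invMulMap (f : G →* L) (g : H →* L) (p : G × H) : L :=
  (f p.1)⁻¹ * g p.2

theorem invMulMap_mul (f : G →* L) (g : H →* L) (p q : G × H) :
    invMulMap f g (p * q) = (f q.1)⁻¹ * invMulMap f g p * g q.2 := by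
  simp [invMulMap, mul_assoc]

/-- The value at a product pq depends on p only through its own value, so p may be replaced by u.
This is the source of transport between fibres. -/
theorem invMulMap_mul_inv_mul {f : G →* L} {g : H →* L} {p u : G × H}
    (h : invMulMap f g p = invMulMap f g u) (v : G × H) :
    invMulMap f g (p * (u⁻¹ * v)) = invMulMap f g v := by
  rw [invMulMap_mul, h]
  simp [invMulMap, mul_assoc]

theorem range_invMulMap_swap (f : G →* L) (g : H →* L) :
    Set.range (invMulMap g f) = (Set.range (invMulMap f g))⁻¹ := by
  ext w
  constructor
  · rintro ⟨p, rfl⟩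
    exact ⟨p.swap, by simp [invMulMap]⟩
  · rintro ⟨p, hp⟩
    exact ⟨p.swap, inv_injective (by rw [← hp]; simp [invMulMap])⟩

/-- `p` has a continuous section over `U`. -/
def HasSectionOn {E X : Type*} [TopologicalSpace E] [TopologicalSpace X] (p : E → X)
    (U : Set X) : Prop :=
  ∃ s : U → E, Continuous s ∧ ∀ x : U, p (s x) = x

theorem HasSectionOn.subset_range {E X : Type*} [TopologicalSpace E] [TopologicalSpace X]
    {p : E → X} {U : Set X} (h : HasSectionOn p U) : U ⊆ Set.range p := by
  obtain ⟨s, -, hs⟩ := h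
  exact fun x hx ↦ ⟨s ⟨x, hx⟩, hs ⟨x, hx⟩⟩

variable {f : G →* L} {g : H →* L} [TopologicalSpace L] [IsTopologicalGroup L]

/-- If the image of `(S, T) ↦ f(S)⁻¹ g(T)` is open and the closure of the image of `g` is a
neighbourhood of the identity, then the image is closed. -/
theorem isClosed_range_invMulMap (hopen : IsOpen (Set.range (invMulMap f g)))
    (hg : closure (Set.range g) ∈ 𝓝 1) : IsClosed (Set.range (invMulMap f g)) := by
  -- The image is stable under right multiplication by g(T) and is a neighbourhood of 1. For y in
  -- the closure, some x = g(T) near y has yx⁻¹ in the image, hence so is y.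
  have hsub : closure (Set.range g) ⊆ Set.range (invMulMap f g) := by
    intro y hy
    have h1 : (1 : L) ∈ Set.range (invMulMap f g) := ⟨1, by simp [invMulMap]⟩
    have hV : {x | y * x⁻¹ ∈ Set.range (invMulMap f g)} ∈ 𝓝 y := by
      have hc : Continuous fun x : L ↦ y * x⁻¹ := by fun_prop
      exact (hopen.preimage hc).mem_nhds (by rw [Set.mem_preimage, mul_inv_cancel]; exact h1)
    obtain ⟨_, ⟨p, hp⟩, ⟨T, rfl⟩⟩ := mem_closure_iff_nhds.1 hy _ hV
    refine ⟨(p.1, p.2 * T), ?_⟩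
    rw [eq_mul_inv_iff_mul_eq] at hp
    rw [← hp]
    simp [invMulMap, mul_assoc]
  let K : Subgroup L := g.range.topologicalClosure
  have hKc : (K : Set L) = closure (Set.range g) := by
    rw [Subgroup.topologicalClosure_coe, MonoidHom.coe_range]
  rw [← isOpen_compl_iff, isOpen_iff_mem_nhds]
  intro w hw
  -- The coset wK misses the image: if f(S)⁻¹ g(T) = wk, then w = f(S)⁻¹ (g(T) k⁻¹) with g(T) k⁻¹ in
  -- K, thus in the image, which is stable under left multiplication by f(S)⁻¹.
  have hV : {v | w⁻¹ * v ∈ K} ∈ 𝓝 w := by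
    have hc : Continuous fun v : L ↦ w⁻¹ * v := by fun_prop
    refine hc.continuousAt.preimage_mem_nhds (t := (K : Set L)) ?_
    rwa [inv_mul_cancel, hKc]
  filter_upwards [hV] with v hv ⟨p, hp⟩
  apply hw
  have hTK : g p.2 * (w⁻¹ * v)⁻¹ ∈ K :=
    K.mul_mem (Subgroup.le_topologicalClosure _ ⟨p.2, rfl⟩) (K.inv_mem hv)
  rw [← SetLike.mem_coe, hKc] at hTK
  obtain ⟨q, hq⟩ := hsub hTK
  refine ⟨(q.1 * p.1, q.2), ?_⟩
  have h2 : invMulMap f g (q.1 * p.1, q.2) = (f p.1)⁻¹ * invMulMap f g q := by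
    simp [invMulMap, mul_assoc]
  rw [h2, hq, ← hp]
  simp [invMulMap, mul_assoc]

variable [TopologicalSpace G] [TopologicalSpace H]

theorem continuous_invMulMap (hf : Continuous f) (hg : Continuous g) :
    Continuous (invMulMap f g) :=
  (hf.comp continuous_fst).inv.mul (hg.comp continuous_snd)

variable [IsTopologicalGroup G] [IsTopologicalGroup H]

theorem exists_section_at {N : Set L} (hN : IsOpen N) (h1 : 1 ∈ N)
    (hs : HasSectionOn (invMulMap f g) N) {w : L} (hw : w ∈ Set.range (invMulMap f g)) :
    ∃ U, IsOpen U ∧ w ∈ U ∧ HasSectionOn (invMulMap f g) U := by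
  obtain ⟨p, rfl⟩ := hw
  obtain ⟨s, hsc, hs⟩ := hs
  -- The two-sided translation taking the value at p to 1; right multiplication by p undoes it
  -- upstairs.
  let t : L → L := fun v ↦ f p.1 * v * (g p.2)⁻¹
  have ht : Continuous t := by fun_prop
  refine ⟨t ⁻¹' N, hN.preimage ht, ?_, fun v ↦ s ⟨t v, v.2⟩ * p, ?_, fun v ↦ ?_⟩
  · have : t (invMulMap f g p) = 1 := by simp [t, invMulMap, mul_assoc]
    rwa [Set.mem_preimage, this]
  · exact (hsc.comp ((ht.comp continuous_subtype_val).subtype_mk _)).mul continuous_const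
  · rw [invMulMap_mul, hs]
    simp [t, mul_assoc]

theorem isOpen_range_invMulMap {N : Set L} (hN : IsOpen N) (h1 : 1 ∈ N)
    (hs : HasSectionOn (invMulMap f g) N) : IsOpen (Set.range (invMulMap f g)) := by
  rw [isOpen_iff_mem_nhds]
  intro w hw
  obtain ⟨U, hU, hwU, hsU⟩ := exists_section_at hN h1 hs hw
  exact Filter.mem_of_superset (hU.mem_nhds hwU) hsU.subset_range

theorem HasSectionOn.hasTransportOn (hf : Continuous f) (hg : Continuous g) {U : Set L}
    (h : HasSectionOn (invMulMap f g) U) : HasTransportOn (invMulMap f g) U := by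
  obtain ⟨s, hsc, hs⟩ := h
  refine ⟨fun q ↦ q.1.1 * ((s ⟨invMulMap f g q.1.1, q.2.1⟩)⁻¹ * s ⟨q.1.2, q.2.2⟩), ?_, fun q ↦ ?_,
    fun q hq ↦ ?_⟩
  · refine (continuous_fst.comp continuous_subtype_val).mul (Continuous.mul ?_ ?_)
    · exact (hsc.comp (((continuous_invMulMap hf hg).comp
        (continuous_fst.comp continuous_subtype_val)).subtype_mk _)).inv
    · exact hsc.comp ((continuous_snd.comp continuous_subtype_val).subtype_mk _)
  · exact (invMulMap_mul_inv_mul (hs ⟨invMulMap f g q.1.1, q.2.1⟩).symm _).trans (hs ⟨q.1.2, q.2.2⟩)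
  · have : s ⟨invMulMap f g q.1.1, q.2.1⟩ = s ⟨q.1.2, q.2.2⟩ := congrArg s (Subtype.ext hq)
    simp only [this, inv_mul_cancel, mul_one]

theorem isSerreFibration_invMulMap (hf : Continuous f) (hg : Continuous g) {N : Set L}
    (hN : IsOpen N) (h1 : 1 ∈ N) (hs : HasSectionOn (invMulMap f g) N)
    (hclosed : IsClosed (Set.range (invMulMap f g))) : IsSerreFibration (invMulMap f g) where
  continuous := continuous_invMulMap hf hg
  lifting k F K hF hK h0 := by
    refine exists_homotopy_lift_of_transport (fun w ↦ ?_) hF hK h0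
    by_cases hw : w ∈ Set.range (invMulMap f g)
    · obtain ⟨U, hU, hwU, hsU⟩ := exists_section_at hN h1 hs hw
      exact ⟨U, hU, hwU, hsU.hasTransportOn hf hg⟩
    -- Off the image transport is vacuous, and closedness makes the complement an admissible open
    -- set.
    · have hempty : IsEmpty {q : (G × H) × L // invMulMap f g q.1 ∈ (Set.range (invMulMap f g))ᶜ ∧
          q.2 ∈ (Set.range (invMulMap f g))ᶜ} := ⟨fun q ↦ q.2.1 ⟨q.1.1, rfl⟩⟩
      exact ⟨_, hclosed.isOpen_compl, hw, hempty.elim, continuous_of_const fun q ↦ hempty.elim q,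
        fun q ↦ hempty.elim q, fun q ↦ hempty.elim q⟩

/-- If `Q` is the pullback of `f` and `g`, and `(S, T) ↦ f(S)⁻¹ g(T)` has local sections, then it is
a principal `Q`-bundle over its image. -/
theorem isPrincipalBundle_invMulMap [TopologicalSpace Q] [IsTopologicalGroup Q] (hf : Continuous f)
    (hg : Continuous g) {N : Set L} (hN : IsOpen N) (h1 : 1 ∈ N)
    (hs : HasSectionOn (invMulMap f g) N) {b : Q →* G} {c : Q →* H}
    (hcomm : ∀ q, f (b q) = g (c q)) (hemb : IsEmbedding (b.prod c))
    (hpull : ∀ S T, f S = g T → ∃ q, b q = S ∧ c q = T) :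
    IsPrincipalBundle Q (action := MulAction.compHom _ (b.prod c))
      (Set.rangeFactorization (invMulMap f g)) := by
  have hmul : ∀ q p, invMulMap f g (b.prod c q * p) = invMulMap f g p := fun q p ↦ by
    simp [invMulMap, mul_assoc, hcomm]
  let _ : MulAction Q (G × H) := MulAction.compHom _ (b.prod c)
  have hsmul : ∀ (q : Q) (p : G × H), q • p = b.prod c q * p := fun _ _ ↦ rfl
  refine ⟨(continuous_invMulMap hf hg).subtype_mk _, ?_, fun q p ↦ Subtype.ext (hmul q p), ?_⟩
  · simp only [hsmul]
    exact (hemb.continuous.comp continuous_fst).mul continuous_snd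
  rintro ⟨w, hw⟩
  obtain ⟨U, hU, hwU, s, hsc, hs⟩ := exists_section_at hN h1 hs hw
  let V : Set (Set.range (invMulMap f g)) := Subtype.val ⁻¹' U
  let E := Set.rangeFactorization (invMulMap f g) ⁻¹' V
  let σ : V → G × H := fun v ↦ s ⟨v, v.2⟩
  have hσc : Continuous σ :=
    hsc.comp ((continuous_subtype_val.comp continuous_subtype_val).subtype_mk _)
  have hσ : ∀ v, invMulMap f g (σ v) = v := fun v ↦ hs _
  let π : E → V := fun e ↦ ⟨Set.rangeFactorization (invMulMap f g) e, e.2⟩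
  have hπc : Continuous π := (((continuous_invMulMap hf hg).comp
    continuous_subtype_val).subtype_mk _).subtype_mk _
  -- Since e and σ(π e) lie in one fibre, the components of their quotient have equal images under f
  -- and g, so the quotient comes from Q.
  have hex : ∀ e : E, ∃ q, b.prod c q = e * (σ (π e))⁻¹ := by
    intro e
    have h2 : invMulMap f g (σ (π e)) = invMulMap f g e := hσ _
    obtain ⟨q, hq1, hq2⟩ := hpull ((e : G × H).1 * (σ (π e)).1⁻¹)
      ((e : G × H).2 * (σ (π e)).2⁻¹) (by
      simp only [invMulMap] at h2
      simp only [map_mul, map_inv]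
      rw [eq_mul_inv_iff_mul_eq, mul_assoc, h2]
      simp)
    exact ⟨q, Prod.ext hq1 hq2⟩
  choose τ hτ using hex
  have hτc : Continuous τ := by
    rw [hemb.continuous_iff]
    exact (continuous_subtype_val.mul (hσc.comp hπc).inv).congr fun e ↦ (hτ e).symm
  have hmem : ∀ x : Q × V, b.prod c x.1 * σ x.2 ∈ E := by
    intro x
    change invMulMap f g (b.prod c x.1 * σ x.2) ∈ U
    rw [hmul, hσ]
    exact x.2.2
  have hπinv : ∀ x : Q × V, π ⟨b.prod c x.1 * σ x.2, hmem x⟩ = x.2 := fun x ↦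
    Subtype.ext (Subtype.ext ((hmul _ _).trans (hσ _)))
  let h : E ≃ₜ Q × V :=
    { toFun := fun e ↦ (τ e, π e)
      invFun := fun x ↦ ⟨b.prod c x.1 * σ x.2, hmem x⟩
      left_inv := fun e ↦ Subtype.ext (by simp only [hτ, inv_mul_cancel_right])
      right_inv := fun x ↦ by
        refine Prod.ext (hemb.injective ?_) (hπinv x)
        simp only [hτ, hπinv, mul_inv_cancel_right]
      continuous_toFun := hτc.prodMk hπc
      continuous_invFun := Continuous.subtype_mk
        ((hemb.continuous.comp continuous_fst).mul (hσc.comp continuous_snd)) _ }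
  refine ⟨V, hU.preimage continuous_subtype_val, hwU, h, fun e ↦ rfl, fun q e e' hee' ↦ ?_⟩
  have hπ : π e' = π e := Subtype.ext (Subtype.ext (by
    change invMulMap f g e' = invMulMap f g e
    rw [hee', hsmul, hmul]))
  refine Prod.ext (hemb.injective ?_) hπ
  change b.prod c (τ e') = b.prod c (q * τ e)
  rw [map_mul, hτ, hτ, hπ, hee', hsmul, mul_assoc]

end TopologicalGroups

namespace BanachAlg

/-! ### GL_n(A) as the pullback of GL_n(B) and GL_n(C); closedness of the image. -/

section Pullback

variable {A B C D : Type*}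
  [NonUnitalNormedRing A] [NormedSpace ℂ A]
  [NonUnitalNormedRing B] [NormedSpace ℂ B]
  [NonUnitalNormedRing C] [NormedSpace ℂ C]
  [NonUnitalNormedRing D] [NormedSpace ℂ D]
  {β : A →ₙₐ[ℂ] B} {γ : A →ₙₐ[ℂ] C} {φ : B →ₙₐ[ℂ] D} {ψ : C →ₙₐ[ℂ] D} {n : ℕ}

theorem IsPullbackSquare.isEmbedding (h : IsPullbackSquare β γ φ ψ) :
    IsEmbedding fun a ↦ (β a, γ a) :=
  IsEmbedding.subtypeVal.comp h.isHomeomorph.isEmbedding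

theorem IsPullbackSquare.exists_eq (h : IsPullbackSquare β γ φ ψ) {b : B} {c : C}
    (hbc : φ b = ψ c) : ∃ a, β a = b ∧ γ a = c := by
  obtain ⟨a, ha⟩ := h.isHomeomorph.surjective ⟨(b, c), hbc⟩
  exact ⟨a, congrArg (fun p ↦ p.1.1) ha, congrArg (fun p ↦ p.1.2) ha⟩

theorem map_quasiMul (f : A →ₙₐ[ℂ] B) (a a' : Matrix (Fin n) (Fin n) A) :
    (a + a' + a * a').map f = a.map f + a'.map f + a.map f * a'.map f := by
  ext i j
  simp [Matrix.mul_apply]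

variable [IsScalarTower ℂ B B] [SMulCommClass ℂ B B]
  [IsScalarTower ℂ C C] [SMulCommClass ℂ C C]

theorem IsPullbackSquare.quasiMul_eq_zero (h : IsPullbackSquare β γ φ ψ)
    {a a' : Matrix (Fin n) (Fin n) A} {S S' : GLn B n} {T T' : GLn C n}
    (haS : a.map β = S.coeff) (haT : a.map γ = T.coeff) (haS' : a'.map β = S'.coeff)
    (haT' : a'.map γ = T'.coeff) (hS : S * S' = 1) (hT : T * T' = 1) :
    a + a' + a * a' = 0 := by
  have h1 : (a + a' + a * a').map β = 0 := by
    rw [map_quasiMul, haS, haS', ← GLn.coeff_mul, hS, GLn.coeff_one]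
  have h2 : (a + a' + a * a').map γ = 0 := by
    rw [map_quasiMul, haT, haT', ← GLn.coeff_mul, hT, GLn.coeff_one]
  ext i j
  apply h.isEmbedding.injective
  refine Prod.ext ?_ ?_
  · refine (congrFun (congrFun h1 i) j).trans ?_
    simp
  · refine (congrFun (congrFun h2 i) j).trans ?_
    simp

variable [IsScalarTower ℂ D D] [SMulCommClass ℂ D D]

theorem IsPullbackSquare.exists_matrix_eq (h : IsPullbackSquare β γ φ ψ) {S : GLn B n}
    {T : GLn C n} (hST : GLn.map n φ S = GLn.map n ψ T) :
    ∃ a : Matrix (Fin n) (Fin n) A, a.map β = S.coeff ∧ a.map γ = T.coeff := by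
  have h1 : ∀ i j, φ (S.coeff i j) = ψ (T.coeff i j) := fun i j ↦ by
    have h2 := congrArg (fun W : GLn D n ↦ W.coeff i j) hST
    simpa only [GLn.coeff_map, Matrix.map_apply] using h2
  choose a ha using fun i j ↦ h.exists_eq (h1 i j)
  exact ⟨Matrix.of a, by ext i j; exact (ha i j).1, by ext i j; exact (ha i j).2⟩

variable [IsScalarTower ℂ A A] [SMulCommClass ℂ A A]

theorem IsPullbackSquare.map_map (h : IsPullbackSquare β γ φ ψ) (S : GLn A n) :
    GLn.map n φ (GLn.map n β S) = GLn.map n ψ (GLn.map n γ S) := by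
  apply GLn.coeff_injective
  ext i j
  simp only [GLn.coeff_map, Matrix.map_apply]
  exact h.comm _

omit [IsScalarTower ℂ D D] [SMulCommClass ℂ D D] in
theorem IsPullbackSquare.isEmbedding_map (h : IsPullbackSquare β γ φ ψ) [CompleteSpace A]
    [CompleteSpace B] [CompleteSpace C] (hβ : Continuous β) (hγ : Continuous γ) :
    IsEmbedding ((GLn.map n β).prod (GLn.map n γ)) := by
  let F : GLn B n × GLn C n → Fin n → Fin n → B × C :=
    fun p i j ↦ (p.1.coeff i j, p.2.coeff i j)
  have hF : Continuous F := continuous_pi fun i ↦ continuous_pi fun j ↦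
    (((GLn.continuous_coeff.comp continuous_fst).matrix_elem i j).prodMk
      ((GLn.continuous_coeff.comp continuous_snd).matrix_elem i j))
  refine IsEmbedding.of_comp ((GLn.continuous_map hβ).prodMk (GLn.continuous_map hγ)) hF ?_
  have hpi : IsEmbedding (Pi.map fun _ : Fin n ↦ Pi.map fun _ : Fin n ↦ fun a ↦ (β a, γ a)) :=
    IsEmbedding.piMap fun _ ↦ IsEmbedding.piMap fun _ ↦ h.isEmbedding
  have hcomp : F ∘ (GLn.map n β).prod (GLn.map n γ) =
      (Pi.map fun _ : Fin n ↦ Pi.map fun _ : Fin n ↦ fun a ↦ (β a, γ a)) ∘ GLn.coeff := by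
    funext S i j
    simp only [F, Function.comp_apply, MonoidHom.prod_apply, GLn.coeff_map, Matrix.map_apply]
    rfl
  rw [hcomp]
  exact hpi.comp GLn.isEmbedding_coeff

/-- Coefficients lift entrywise to a matrix a over A. Lifting those of the inverses as well gives a
quasi-inverse of a, since the quasi-products vanish in B and C and hence in A. -/
theorem IsPullbackSquare.exists_map_eq (h : IsPullbackSquare β γ φ ψ) {S : GLn B n}
    {T : GLn C n} (hST : GLn.map n φ S = GLn.map n ψ T) :
    ∃ R : GLn A n, GLn.map n β R = S ∧ GLn.map n γ R = T := by
  obtain ⟨a, haS, haT⟩ := h.exists_matrix_eq hST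
  obtain ⟨a', haS', haT'⟩ := h.exists_matrix_eq (S := S⁻¹) (T := T⁻¹) (by
    rw [map_inv, map_inv, hST])
  obtain ⟨R, hR⟩ := GLn.exists_coeff_eq
    (h.quasiMul_eq_zero haS haT haS' haT' (mul_inv_cancel S) (mul_inv_cancel T))
    (h.quasiMul_eq_zero haS' haT' haS haT (inv_mul_cancel S) (inv_mul_cancel T))
  exact ⟨R, GLn.coeff_injective (by rw [GLn.coeff_map, hR, haS]),
    GLn.coeff_injective (by rw [GLn.coeff_map, hR, haT])⟩

theorem isClosed_range_quotientMap [CompleteSpace B] [CompleteSpace C] [CompleteSpace D]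
    (hφ : Continuous φ) (hψ : Continuous ψ) (hdense : DenseRange φ ∨ DenseRange ψ)
    (hopen : IsOpen (Set.range (quotientMap n φ ψ))) :
    IsClosed (Set.range (quotientMap n φ ψ)) := by
  change IsOpen (Set.range (invMulMap (GLn.map n φ) (GLn.map n ψ))) at hopen
  change IsClosed (Set.range (invMulMap (GLn.map n φ) (GLn.map n ψ)))
  rcases hdense with h | h
  -- Inversion exchanges the roles of φ and ψ and preserves open and closed sets.
  · rw [range_invMulMap_swap]
    refine IsClosed.inv (isClosed_range_invMulMap ?_ (GLn.closure_range_map_mem_nhds hφ h))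
    rw [range_invMulMap_swap]
    exact hopen.inv
  · exact isClosed_range_invMulMap hopen (GLn.closure_range_map_mem_nhds hψ h)

end Pullback

end BanachAlg

end

theorem mainTheorem5 {A B C D : Type*}
    [NonUnitalNormedRing A] [NormedSpace ℂ A] [IsScalarTower ℂ A A] [SMulCommClass ℂ A A]
    [CompleteSpace A]
    [NonUnitalNormedRing B] [NormedSpace ℂ B] [IsScalarTower ℂ B B] [SMulCommClass ℂ B B]
    [CompleteSpace B]
    [NonUnitalNormedRing C] [NormedSpace ℂ C] [IsScalarTower ℂ C C] [SMulCommClass ℂ C C]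
    [CompleteSpace C]
    [NonUnitalNormedRing D] [NormedSpace ℂ D] [IsScalarTower ℂ D D] [SMulCommClass ℂ D D]
    [CompleteSpace D]
    (β : A →ₙₐ[ℂ] B) (γ : A →ₙₐ[ℂ] C) (φ : B →ₙₐ[ℂ] D) (ψ : C →ₙₐ[ℂ] D)
    (hβ : Continuous β) (hγ : Continuous γ) (hφ : Continuous φ) (hψ : Continuous ψ)
    (hpull : BanachAlg.IsPullbackSquare β γ φ ψ)
    (hsum : ∀ d : D, ∃ (b : B) (c : C), φ b + ψ c = d)
    (hdense : DenseRange φ ∨ DenseRange ψ)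
    (n : ℕ) :
    IsSerreFibration (BanachAlg.quotientMap n φ ψ) ∧
    IsOpen (Set.range (BanachAlg.quotientMap n φ ψ)) ∧
    IsClosed (Set.range (BanachAlg.quotientMap n φ ψ)) ∧
    IsPrincipalBundle (BanachAlg.GLn A n) (action := BanachAlg.glnAction n β γ)
      (Set.rangeFactorization (BanachAlg.quotientMap n φ ψ)) := by
  obtain ⟨N, hN, h1, hs⟩ := BanachAlg.exists_section_near_one (n := n) hφ hψ hsum
  have hs' : HasSectionOn (invMulMap (BanachAlg.GLn.map n φ) (BanachAlg.GLn.map n ψ)) N := hs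
  have hopen : IsOpen (Set.range (BanachAlg.quotientMap n φ ψ)) := isOpen_range_invMulMap hN h1 hs'
  have hclosed := BanachAlg.isClosed_range_quotientMap hφ hψ hdense hopen
  have hφc := BanachAlg.GLn.continuous_map (n := n) hφ
  have hψc := BanachAlg.GLn.continuous_map (n := n) hψ
  exact ⟨isSerreFibration_invMulMap hφc hψc hN h1 hs' hclosed, hopen, hclosed,
    isPrincipalBundle_invMulMap hφc hψc hN h1 hs' hpull.map_map (hpull.isEmbedding_map hβ hγ)
      fun S T h ↦ hpull.exists_map_eq h⟩
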